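/- **Conventions.** Ordinary Young diagrams are denoted $\sigma,\rho,\tau$, and shifted Young diagrams (that is, strict partitions $\lambda=(\lambda_1>\dots>\lambda_{\ell(\lambda)}>0)$, with row $i$ shifted $i-1$ steps to the right) are denoted $\mu,\lambda$. $|\cdot|$ is the number of boxes, $\ell(\lambda)$ is the number of nonempty rows, and $c(\square)=j-i$ is the content of the box in row $i$ and column $j$. Write $\sigma\nearrow\rho$ (respectively $\mu\Nearrow\lambda$) if the second diagram is obtained from the first by adding one box. Let $f_\rho$ (respectively $g_\lambda$) be the number of paths $\varnothing\nearrow\cdots\nearrow\rho$ (respectively $\varnothing\Nearrow\cdots\Nearrow\lambda$). The *doubling* $\mathcal D\lambda$ is the ordinary Young diagram with Frobenius coordinates $(\lambda_1,\dots,\lambda_\ell\mid\lambda_1-1,\dots,\lambda_\ell-1)$; the diagrams of the form $\mathcal D\lambda$ are called *$\mathcal D$-symmetric*. The up transition probabilities of the $z$-measures are, for $\sigma\nearrow\rho$ and $\square=\rho\setminus\sigma$, $$p^{\uparrow}_{z,z'}(\sigma,\rho)=\frac{(z+c(\square))(z'+c(\square))}{zz'+|\sigma|}\cdot\frac{f_\rho}{(|\sigma|+1)f_\sigma},$$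 and those of Borodin's measures on strict partitions are, for $\mu\Nearrow\lambda$ and $\square=\lambda\setminus\mu$, $$p^{\Uparrow}_{\alpha}(\mu,\lambda)=\frac{c(\square)(c(\square)+1)+\alpha}{2|\mu|+\alpha}\cdot\frac{g_\lambda}{(|\mu|+1)g_\mu}\,2^{\ell(\mu)-\ell(\lambda)+1};$$ both are $0$ for all other pairs of diagrams. Let $\mathbb M^\alpha_n$ be the distribution after $n$ steps of the growth process of shifted diagrams that starts from $\varnothing$ and has transition probabilities $p^\Uparrow_\alpha$, i.e. $\mathbb M^\alpha_0=\delta_\varnothing$ and $\mathbb M^\alpha_{n+1}(\lambda)=\sum_\mu\mathbb M^\alpha_n(\mu)\,p^\Uparrow_\alpha(\mu,\lambda)$. **Proposition.** Let $\alpha>0$, $\nu=\tfrac12\sqrt{1-4\alpha}$ (principal value), $z=\nu-\tfrac12$ and $z'=-\nu-\tfrac12$. 1. The parameters $z,z'$ are admissible for the $z$-measures: either $z'=\bar z$ and $z\in\mathbb C\setminus\mathbb Z$, or $z,z'$ are real and $m<z,z'<m+1$ for some $m\in\mathbb Z$. 2. Let $\mu\Nearrow\lambda$. Then $\ell(\lambda)\in\{\ell(\mu),\ell(\mu)+1\}$.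 If $\ell(\lambda)=\ell(\mu)$, there are exactly two ordinary diagrams $\rho^{(a)}\ne\rho^{(b)}$ with $\mathcal D\mu\nearrow\rho^{(a),(b)}\nearrow\mathcal D\lambda$, and $$p^\Uparrow_\alpha(\mu,\lambda)=p^\uparrow_{z,z'}(\mathcal D\mu,\rho^{(a)})+p^\uparrow_{z,z'}(\mathcal D\mu,\rho^{(b)}).$$ If $\ell(\lambda)=\ell(\mu)+1$, there is exactly one ordinary diagram $\rho$ with $\mathcal D\mu\nearrow\rho\nearrow\mathcal D\lambda$, and $$p^\Uparrow_\alpha(\mu,\lambda)=p^\uparrow_{z,z'}(\mathcal D\mu,\rho).$$ 3. Consequently, the growth process for $\mathbb M^\alpha_n$ is the forced $\mathcal D$-symmetrization of the growth process for the $z$-measures with parameters $z,z'$. Precisely: if $\mathcal D\mu\nearrow\rho$, there is exactly one $\mathcal D$-symmetric $\tau$ with $\rho\nearrow\tau$. Consider the growth of ordinary diagrams that starts from $\varnothing$ and has steps numbered $0,1,2,\dots$, where each even step adds a box according to $p^\uparrow_{z,z'}$ and each odd step adds the unique box that makes the diagram $\mathcal D$-symmetric again. Let $W_k$ be its distribution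 after $k$ steps, given by the corresponding recursion from $W_0=\delta_\varnothing$. Then, for every $n\ge0$, $W_{2n}(\mathcal D\lambda)=\mathbb M^\alpha_n(\lambda)$ for all shifted diagrams $\lambda$, and $W_{2n}$ vanishes outside $\{\mathcal D\lambda:|\lambda|=n\}$. -/

import Mathlib

/-- The content `j - i` of the box in row `i` and column `j`. Rows and columns are numbered
from `0`; this does not change contents. -/
def boxContent (c : ℕ × ℕ) : ℤ := (c.2 : ℤ) - (c.1 : ℤ)

/-- Paths `a → ⋯ → b` in the directed graph with edge relation `r`. -/
inductive UpPath {V : Type} (r : V → V → Prop) (a : V) : V → Type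
  | nil : UpPath r a a
  | snoc {b c : V} (p : UpPath r a b) (h : r b c) : UpPath r a c

/-! ### Ordinary Young diagrams -/

/-- `σ ↗ ρ`: the Young diagram `ρ` is obtained from `σ` by adding one box. -/
def YoungDiagram.Up (σ ρ : YoungDiagram) : Prop :=
  σ ≤ ρ ∧ ρ.card = σ.card + 1

/-- `f_ρ`: the number of paths in the Young graph from the empty diagram to `ρ`. -/
noncomputable def YoungDiagram.pathCount (ρ : YoungDiagram) : ℕ :=
  Nat.card (UpPath YoungDiagram.Up ⊥ ρ)

/-- The content of the box `ρ \ σ` (meaningful when `σ ↗ ρ`: then the sum has one term). -/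
def YoungDiagram.addedContent (σ ρ : YoungDiagram) : ℤ :=
  ∑ c ∈ ρ.cells \ σ.cells, boxContent c

open Classical in
/-- The up transition probabilities of the Plancherel measures on the Young graph. -/
noncomputable def YoungDiagram.plancherelUp (σ ρ : YoungDiagram) : ℝ :=
  if σ.Up ρ then (ρ.pathCount : ℝ) / (((σ.card : ℝ) + 1) * (σ.pathCount : ℝ)) else 0

/-- The up transition probabilities of the `z`-measures on the Young graph
(they vanish unless `σ ↗ ρ`, because `plancherelUp` does). -/
noncomputable def YoungDiagram.zUp (z z' : ℂ) (σ ρ : YoungDiagram) : ℂ :=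
  (z + (σ.addedContent ρ : ℂ)) * (z' + (σ.addedContent ρ : ℂ)) / (z * z' + (σ.card : ℂ))
    * (σ.plancherelUp ρ : ℂ)

/-- The admissible parameters of the `z`-measures: the principal and the complementary series. -/
def ZAdmissible (z z' : ℂ) : Prop :=
  (z' = (starRingEnd ℂ) z ∧ ∀ m : ℤ, z ≠ (m : ℂ)) ∨
  ∃ x x' : ℝ, z = (x : ℂ) ∧ z' = (x' : ℂ) ∧
    ∃ m : ℤ, (m : ℝ) < x ∧ x < m + 1 ∧ (m : ℝ) < x' ∧ x' < m + 1

/-! ### Shifted Young diagrams -/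

/-- A shifted Young diagram: a finite set of boxes `(i, j)` with `i ≤ j` which with each box
contains all boxes of `{(i, j) : i ≤ j}` weakly above and to the left of it.
The `i`-th row is `{(i, j) : i ≤ j < i + part i}`, where `part 0 > part 1 > ⋯` is the
corresponding strict partition (see `ShiftedDiagram.mem_iff` and
`ShiftedDiagram.part_succ_lt` below). -/
@[ext]
structure ShiftedDiagram where
  cells : Finset (ℕ × ℕ)
  le_of_mem : ∀ c ∈ cells, c.1 ≤ c.2
  closed : ∀ c ∈ cells, ∀ d : ℕ × ℕ, d.1 ≤ d.2 → d.1 ≤ c.1 → d.2 ≤ c.2 → d ∈ cells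

namespace ShiftedDiagram

/-- The empty shifted diagram. -/
def empty : ShiftedDiagram where
  cells := ∅
  le_of_mem := by simp
  closed := by simp

/-- `|lam|`: the number of boxes. -/
def card (lam : ShiftedDiagram) : ℕ := lam.cells.card

/-- The `i`-th part of the corresponding strict partition: the number of boxes in row `i`. -/
def part (lam : ShiftedDiagram) (i : ℕ) : ℕ := (lam.cells.filter fun c => c.1 = i).card

/-- `ℓ(lam)`: the number of nonempty rows. -/
def length (lam : ShiftedDiagram) : ℕ := (lam.cells.image Prod.fst).card

theorem mem_iff (lam : ShiftedDiagram) (i j : ℕ) :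
    (i, j) ∈ lam.cells ↔ i ≤ j ∧ j < i + lam.part i := by
  have key : ∀ j, (i, j) ∈ lam.cells → ∀ k, i ≤ k → k ≤ j → (i, k) ∈ lam.cells :=
    fun j hj k h1 h2 => lam.closed _ hj _ h1 le_rfl h2
  constructor
  · intro h
    have hij := lam.le_of_mem _ h
    refine ⟨hij, ?_⟩
    have hsub : (Finset.Icc i j).image (fun k => (i, k)) ⊆ lam.cells.filter fun c => c.1 = i := by
      intro c hc
      simp only [Finset.mem_image, Finset.mem_Icc] at hc
      obtain ⟨k, ⟨h1, h2⟩, rfl⟩ := hc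
      simp [key j h k h1 h2]
    have := Finset.card_le_card hsub
    rw [Finset.card_image_of_injective _ (fun a b hab => by simpa using hab), Nat.card_Icc] at this
    simp only at hij
    unfold part
    omega
  · rintro ⟨hij, hj⟩
    by_contra hn
    have hsub : (lam.cells.filter fun c => c.1 = i) ⊆ (Finset.Ico i j).image (fun k => (i, k)) := by
      rintro ⟨a, b⟩ hc
      simp only [Finset.mem_filter] at hc
      obtain ⟨hc, rfl⟩ := hc
      have hab := lam.le_of_mem _ hc
      simp only at hab
      have hb : b < j := by
        by_contra hb
        exact hn (key b hc j hij (not_lt.mp hb))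
      simp [hab, hb]
    have := Finset.card_le_card hsub
    rw [Finset.card_image_of_injective _ (fun a b hab => by simpa using hab), Nat.card_Ico] at this
    unfold part at hj
    omega

theorem part_succ_lt (lam : ShiftedDiagram) (i : ℕ) (h : lam.part (i + 1) ≠ 0) :
    lam.part (i + 1) < lam.part i := by
  have h1 : (i + 1, i + lam.part (i + 1)) ∈ lam.cells := by
    rw [mem_iff]; omega
  have h2 := lam.closed _ h1 (i, i + lam.part (i + 1)) (by simp) (by simp) le_rfl
  rw [mem_iff] at h2
  omega

theorem lt_length_iff (lam : ShiftedDiagram) (i : ℕ) :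
    i < lam.length ↔ 0 < lam.part i := by
  have hd : ∀ k, k ∈ lam.cells.image Prod.fst ↔ (k, k) ∈ lam.cells := by
    intro k
    simp only [Finset.mem_image]
    constructor
    · rintro ⟨c, hc, rfl⟩
      exact lam.closed c hc _ le_rfl le_rfl (lam.le_of_mem c hc)
    · intro h
      exact ⟨_, h, rfl⟩
  have hpos : (i, i) ∈ lam.cells ↔ 0 < lam.part i := by
    rw [mem_iff]; omega
  rw [← hpos]
  constructor
  · intro h
    by_contra hn
    have hsub : lam.cells.image Prod.fst ⊆ Finset.range i := by
      intro k hk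
      rw [hd] at hk
      rw [Finset.mem_range]
      by_contra hki
      exact hn (lam.closed _ hk (i, i) le_rfl (not_lt.mp hki) (not_lt.mp hki))
    have := Finset.card_le_card hsub
    rw [Finset.card_range] at this
    unfold length at h
    omega
  · intro h
    have hsub : Finset.range (i + 1) ⊆ lam.cells.image Prod.fst := by
      intro k hk
      rw [Finset.mem_range] at hk
      rw [hd]
      exact lam.closed _ h (k, k) le_rfl (by simp; omega) (by simp; omega)
    have := Finset.card_le_card hsub
    rw [Finset.card_range] at this
    unfold length
    omega

/-- `mu ⇗ lam`: the shifted diagram `lam` is obtained from `mu` by adding one box. -/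
def Up (mu lam : ShiftedDiagram) : Prop :=
  mu.cells ⊆ lam.cells ∧ lam.card = mu.card + 1

/-- `g_lam`: the number of paths in the Schur graph from the empty diagram to `lam`. -/
noncomputable def pathCount (lam : ShiftedDiagram) : ℕ :=
  Nat.card (UpPath Up empty lam)

/-- The content of the box `lam \ mu` (meaningful when `mu ⇗ lam`: then the sum has one term). -/
def addedContent (mu lam : ShiftedDiagram) : ℤ :=
  ∑ c ∈ lam.cells \ mu.cells, boxContent c

open Classical in
/-- The up transition probabilities of the Plancherel measures on the Schur graph. -/
noncomputable def plancherelUp (mu lam : ShiftedDiagram) : ℝ :=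
  if mu.Up lam then
    (lam.pathCount : ℝ) / (((mu.card : ℝ) + 1) * (mu.pathCount : ℝ))
      * (2 : ℝ) ^ ((mu.length : ℤ) - (lam.length : ℤ) + 1)
  else 0

/-- The up transition probabilities of Borodin's coherent system with parameter `α`
(they vanish unless `mu ⇗ lam`, because `plancherelUp` does). -/
noncomputable def alphaUp (α : ℝ) (mu lam : ShiftedDiagram) : ℝ :=
  ((mu.addedContent lam : ℝ) * ((mu.addedContent lam : ℝ) + 1) + α) / (2 * (mu.card : ℝ) + α)
    * mu.plancherelUp lam

open Classical in
/-- Borodin's measures on the levels of the Schur graph: the distribution, after `n` steps, of the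
random growth process that starts from the empty diagram and adds a box at each step with the up
transition probabilities `alphaUp α`. -/
noncomputable def alphaMeasure (α : ℝ) : ℕ → ShiftedDiagram → ℝ
  | 0, lam => if lam = empty then 1 else 0
  | n + 1, lam => ∑ᶠ mu : ShiftedDiagram, alphaMeasure α n mu * mu.alphaUp α lam

/-- The doubling `𝒟 lam`, with the `2 |lam|` boxes `(i, j + 1)` and `(j, i)` for `(i, j) ∈ lam`.
Its Frobenius coordinates are `(part 0, part 1, … | part 0 - 1, part 1 - 1, …)`,
see `doubling_frobenius`. -/
def doubling (lam : ShiftedDiagram) : YoungDiagram where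
  cells := lam.cells.image (fun c => (c.1, c.2 + 1)) ∪ lam.cells.image (fun c => (c.2, c.1))
  isLowerSet := by
    rintro ⟨a, b⟩ ⟨a', b'⟩ hle h
    obtain ⟨h1, h2⟩ := Prod.mk_le_mk.mp hle
    simp only [Finset.coe_union, Finset.coe_image, Set.mem_union, Set.mem_image,
      Finset.mem_coe, Prod.mk.injEq, Prod.exists] at h ⊢
    rcases lt_or_ge a' b' with hab | hab
    · left
      refine ⟨a', b' - 1, ?_, rfl, by omega⟩
      rcases h with ⟨i, j, hm, rfl, rfl⟩ | ⟨i, j, hm, rfl, rfl⟩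
      · exact lam.closed _ hm _ (by simp; omega) (by simp; omega) (by simp; omega)
      · have := lam.le_of_mem _ hm
        simp only at this
        exact lam.closed _ hm _ (by simp; omega) (by simp; omega) (by simp; omega)
    · right
      refine ⟨b', a', ?_, rfl, rfl⟩
      rcases h with ⟨i, j, hm, rfl, rfl⟩ | ⟨i, j, hm, rfl, rfl⟩
      · have := lam.le_of_mem _ hm
        simp only at this
        exact lam.closed _ hm _ (by simp; omega) (by simp; omega) (by simp; omega)
      · exact lam.closed _ hm _ (by simp; omega) (by simp; omega) (by simp; omega)

theorem mem_doubling (lam : ShiftedDiagram) (a b : ℕ) :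
    (a, b) ∈ lam.doubling ↔ (a < b ∧ (a, b - 1) ∈ lam.cells) ∨ (b ≤ a ∧ (b, a) ∈ lam.cells) := by
  rw [← YoungDiagram.mem_cells]
  simp only [doubling, Finset.mem_union, Finset.mem_image, Prod.mk.injEq, Prod.exists]
  constructor
  · rintro (⟨i, j, hm, rfl, rfl⟩ | ⟨i, j, hm, rfl, rfl⟩)
    · have := lam.le_of_mem _ hm
      simp only at this
      exact Or.inl ⟨by omega, by simpa using hm⟩
    · exact Or.inr ⟨lam.le_of_mem _ hm, hm⟩
  · rintro (⟨h, hm⟩ | ⟨h, hm⟩)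
    · exact Or.inl ⟨a, b - 1, hm, rfl, by omega⟩
    · exact Or.inr ⟨b, a, hm, rfl, rfl⟩

/-- The diagonal of `𝒟 lam` has `ℓ(lam)` boxes; its `i`-th box has arm length `part i` and leg
length `part i - 1`. -/
theorem doubling_frobenius (lam : ShiftedDiagram) (i : ℕ) :
    ((i, i) ∈ lam.doubling ↔ i < lam.length) ∧
    (i < lam.length → lam.doubling.rowLen i = (i + 1) + lam.part i ∧
      lam.doubling.colLen i = (i + 1) + (lam.part i - 1)) := by
  have hd : (i, i) ∈ lam.doubling ↔ i < lam.length := by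
    simp only [mem_doubling, lt_length_iff, mem_iff]
    omega
  refine ⟨hd, fun h => ?_⟩
  have hii := hd.mpr h
  have hp := (lt_length_iff lam i).mp h
  have hr := YoungDiagram.mem_iff_lt_rowLen.mp hii
  have hc := YoungDiagram.mem_iff_lt_colLen.mp hii
  constructor
  · refine le_antisymm ?_ ?_
    · by_contra hlt
      have h1 := YoungDiagram.mem_iff_lt_rowLen.mpr (not_le.mp hlt)
      rw [mem_doubling, mem_iff] at h1
      omega
    · by_contra hlt
      have h1 : (i, lam.doubling.rowLen i) ∈ lam.doubling := by
        rw [mem_doubling, mem_iff]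
        omega
      exact lt_irrefl _ (YoungDiagram.mem_iff_lt_rowLen.mp h1)
  · refine le_antisymm ?_ ?_
    · by_contra hlt
      have h1 := YoungDiagram.mem_iff_lt_colLen.mpr (not_le.mp hlt)
      rw [mem_doubling, mem_iff lam i] at h1
      omega
    · by_contra hlt
      have h1 : (lam.doubling.colLen i, i) ∈ lam.doubling := by
        rw [mem_doubling, mem_iff lam i]
        omega
      exact lt_irrefl _ (YoungDiagram.mem_iff_lt_colLen.mp h1)

end ShiftedDiagram

/-- A Young diagram is `𝒟`-symmetric if it is the doubling of a shifted diagram. -/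
def YoungDiagram.DSymmetric (τ : YoungDiagram) : Prop :=
  ∃ lam : ShiftedDiagram, lam.doubling = τ

/-! ### The parameters and the forced symmetrization -/

/-- `ν(α) = ½ √(1 - 4α)` (principal branch). -/
noncomputable def nuParam (α : ℝ) : ℂ := (1 / 2 : ℂ) * (1 - 4 * (α : ℂ)) ^ (1 / 2 : ℂ)

/-- `z(α) = ν(α) - ½`. -/
noncomputable def zParam (α : ℝ) : ℂ := nuParam α - 1 / 2

/-- `z'(α) = -ν(α) - ½`. -/
noncomputable def zParam' (α : ℝ) : ℂ := -nuParam α - 1 / 2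

open Classical in
/-- The transitions of the forced step: from `ρ` go to the `𝒟`-symmetric diagram that is obtained
from `ρ` by adding a box. -/
noncomputable def forcedStep (ρ τ : YoungDiagram) : ℂ :=
  if ρ.Up τ ∧ τ.DSymmetric then 1 else 0

open Classical in
/-- The distribution after `k` steps (numbered `0, 1, 2, …`) of the forced `𝒟`-symmetrization of the
growth process on the Young graph with up transition probabilities `zUp z z'`. The process starts
from the empty diagram; even steps use `zUp z z'`, odd steps are forced. -/
noncomputable def forcedGrowth (z z' : ℂ) : ℕ → YoungDiagram → ℂ
  | 0, ρ => if ρ = ⊥ then 1 else 0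
  | k + 1, ρ =>
    if Even k then ∑ᶠ σ : YoungDiagram, forcedGrowth z z' k σ * σ.zUp z z' ρ
    else ∑ᶠ σ : YoungDiagram, forcedGrowth z z' k σ * forcedStep σ ρ

open Polynomial in
/-- The three leading coefficients of a monic polynomial in terms of its roots. -/
theorem sq_X_mul_nodal_eq {ι F : Type*} [Field F] [CharZero F] [DecidableEq ι] (s : Finset ι)
    (v : ι → F) :
    ∃ r : F[X], r.degree < s.card ∧ X ^ 2 * Lagrange.nodal s v =
      (X ^ 2 - C (∑ i ∈ s, v i) * X
        + C (((∑ i ∈ s, v i) ^ 2 - ∑ i ∈ s, v i ^ 2) / 2)) * X ^ s.card + r := by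
  induction s using Finset.induction_on with
  | empty => exact ⟨0, by simp, by simp⟩
  | insert a s ha ih =>
    obtain ⟨r, hr, h⟩ := ih
    refine ⟨-C (v a * (((∑ i ∈ s, v i) ^ 2 - ∑ i ∈ s, v i ^ 2) / 2)) * X ^ s.card
      + (X - C (v a)) * r, ?_, ?_⟩
    · rw [Finset.card_insert_of_notMem ha]
      refine lt_of_le_of_lt (degree_add_le _ _) (max_lt ?_ ?_)
      · refine lt_of_le_of_lt (b := (s.card : WithBot ℕ)) ?_ (by exact_mod_cast Nat.lt_succ_self _)
        rw [← C_neg]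
        exact degree_C_mul_X_pow_le _ _
      · rw [degree_mul, degree_X_sub_C]
        rcases eq_or_ne r 0 with rfl | hr0
        · simp
        · rw [degree_eq_natDegree hr0] at hr ⊢
          norm_cast at hr ⊢
          omega
    · rw [Lagrange.nodal_insert_eq_nodal ha, Finset.sum_insert ha, Finset.sum_insert ha,
        Finset.card_insert_of_notMem ha, mul_left_comm, h]
      have e : ((v a + ∑ i ∈ s, v i) ^ 2 - (v a ^ 2 + ∑ i ∈ s, v i ^ 2)) / 2
          = ((∑ i ∈ s, v i) ^ 2 - ∑ i ∈ s, v i ^ 2) / 2 + v a * ∑ i ∈ s, v i := by ring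
      rw [e]
      simp only [C_add, C_mul]
      ring

open Polynomial in
/-- The sum of the residues of `∏ (u - x) / ∏ (u - y)` when there is one more zero than there are
poles and the zeros and the poles have the same sum. -/
theorem sum_residues_eq {ι F : Type*} [Field F] [CharZero F] [DecidableEq ι] {s t : Finset ι}
    {v : ι → F} (hv : Set.InjOn v t) (hcard : s.card = t.card + 1)
    (hsum : ∑ i ∈ s, v i = ∑ i ∈ t, v i) :
    ∑ i ∈ t, (∏ j ∈ s, (v i - v j)) / ∏ j ∈ t.erase i, (v i - v j)
      = (∑ i ∈ t, v i ^ 2 - ∑ i ∈ s, v i ^ 2) / 2 := by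
  rcases t.eq_empty_or_nonempty with rfl | ht
  · obtain ⟨a, rfl⟩ := Finset.card_eq_one.mp hcard
    simp_all
  obtain ⟨r₁, hr₁, h₁⟩ := sq_X_mul_nodal_eq s v
  obtain ⟨r₂, hr₂, h₂⟩ := sq_X_mul_nodal_eq t v
  have htpos := ht.card_pos
  obtain ⟨m, hm⟩ : ∃ m, t.card = m + 1 := ⟨t.card - 1, by omega⟩
  set e := (∑ i ∈ t, v i ^ 2 - ∑ i ∈ s, v i ^ 2) / 2 with he
  set Q := Lagrange.nodal s v - X * Lagrange.nodal t v with hQ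
  have hr₂' : (X * r₂).degree < ((m + 2 : ℕ) : WithBot ℕ) := by
    rw [degree_mul, degree_X]
    rcases eq_or_ne r₂ 0 with rfl | hr0
    · simpa using WithBot.bot_lt_coe (m + 2)
    · rw [degree_eq_natDegree hr0] at hr₂ ⊢
      norm_cast at hr₂ ⊢
      omega
  have hr : (r₁ - X * r₂).degree < ((m + 2 : ℕ) : WithBot ℕ) := by
    refine lt_of_le_of_lt (degree_sub_le _ _) (max_lt ?_ hr₂')
    rw [hcard, hm] at hr₁
    exact hr₁
  have key : X ^ 2 * Q = C e * X ^ (m + 2) + (r₁ - X * r₂) := by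
    have hC : C e = C (((∑ i ∈ s, v i) ^ 2 - ∑ i ∈ s, v i ^ 2) / 2)
        - C (((∑ i ∈ t, v i) ^ 2 - ∑ i ∈ t, v i ^ 2) / 2) := by
      rw [← C_sub, he, hsum]
      congr 1
      ring
    rw [hQ, mul_sub, h₁, mul_left_comm, h₂, hC, hcard, hm, hsum]
    ring
  have hdeg : (X ^ 2 * Q).degree < ((m + 3 : ℕ) : WithBot ℕ) := by
    rw [key]
    refine lt_of_le_of_lt (degree_add_le _ _) (max_lt ?_ (hr.trans (by norm_cast; omega)))
    exact lt_of_le_of_lt (degree_C_mul_X_pow_le _ _) (by norm_cast; omega)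
  have hQdeg : Q.degree < t.card := by
    rw [degree_mul, degree_X_pow] at hdeg
    rcases eq_or_ne Q 0 with h0 | h0
    · rw [h0]
      simp
    · rw [degree_eq_natDegree h0] at hdeg ⊢
      norm_cast at hdeg ⊢
      omega
  have hcoeff : Q.coeff m = e := by
    rw [← coeff_X_pow_mul Q 2 m, key, coeff_add, coeff_C_mul_X_pow, if_pos rfl,
      coeff_eq_zero_of_degree_lt hr, add_zero]
  have := Lagrange.coeff_eq_sum hv hQdeg
  rw [hm, Nat.add_sub_cancel, hcoeff] at this
  rw [this]
  refine Finset.sum_congr rfl fun i hi => ?_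
  rw [hQ, eval_sub, eval_mul, Lagrange.eval_nodal_at_node hi, mul_zero, sub_zero,
    Lagrange.eval_nodal]

namespace YoungDiagram

/-- The removable boxes of a diagram. -/
def corners (ρ : YoungDiagram) : Finset (ℕ × ℕ) :=
  ρ.cells.filter fun b => (b.1 + 1, b.2) ∉ ρ ∧ (b.1, b.2 + 1) ∉ ρ

open Classical in
/-- The boxes that can be added to a diagram. -/
noncomputable def outerCorners (ρ : YoungDiagram) : Finset (ℕ × ℕ) :=
  (insert (0, 0) (ρ.cells.image fun b => (b.1 + 1, b.2)) ∪
    ρ.cells.image fun b => (b.1, b.2 + 1)).filter fun b =>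
      b ∉ ρ ∧ (∀ i, b.1 = i + 1 → (i, b.2) ∈ ρ) ∧ ∀ j, b.2 = j + 1 → (b.1, j) ∈ ρ

theorem mem_corners {ρ : YoungDiagram} {i j : ℕ} :
    (i, j) ∈ ρ.corners ↔ (i, j) ∈ ρ ∧ (i + 1, j) ∉ ρ ∧ (i, j + 1) ∉ ρ := by
  simp [corners]

theorem mem_outerCorners {ρ : YoungDiagram} {i j : ℕ} :
    (i, j) ∈ ρ.outerCorners ↔ (i, j) ∉ ρ ∧ (∀ i', i = i' + 1 → (i', j) ∈ ρ) ∧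
      ∀ j', j = j' + 1 → (i, j') ∈ ρ := by
  simp only [outerCorners, Finset.mem_filter, and_iff_right_iff_imp, Finset.mem_union,
    Finset.mem_insert, Finset.mem_image, mem_cells, Prod.exists, Prod.mk.injEq]
  rintro ⟨-, h1, h2⟩
  rcases i with - | i
  · rcases j with - | j
    · simp
    · exact Or.inr ⟨0, j, h2 j rfl, rfl, rfl⟩
  · exact Or.inl (Or.inr ⟨i, j, h1 i rfl, rfl, rfl⟩)

theorem boxes_eq_corners (ρ : YoungDiagram) :
    (({(0, 0)} : Finset (ℕ × ℕ)).val + (ρ.cells.image fun b => (b.1 + 1, b.2)).val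
      + (ρ.cells.image fun b => (b.1, b.2 + 1)).val)
      + (ρ.corners.image fun b => (b.1 + 1, b.2 + 1)).val
    = ρ.outerCorners.val + ρ.cells.val + (ρ.cells.image fun b => (b.1 + 1, b.2 + 1)).val := by
  classical
  ext ⟨i, j⟩
  simp only [Multiset.count_add, Multiset.count_eq_of_nodup (Finset.nodup _), Finset.mem_val,
    mem_outerCorners, Finset.mem_image, mem_cells, Prod.exists, Prod.mk.injEq,
    Finset.mem_singleton, mem_corners]
  have up : ∀ {a b a' b'}, (a, b) ∈ ρ → a' ≤ a → b' ≤ b → (a', b') ∈ ρ :=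
    fun h ha hb => ρ.up_left_mem ha hb h
  rcases i with - | i <;> rcases j with - | j
  · by_cases h : (0, 0) ∈ ρ <;> simp [h]
  · have h1 : (0, j + 1) ∈ ρ → (0, j) ∈ ρ := fun h => up h le_rfl (by omega)
    by_cases h : (0, j) ∈ ρ <;> by_cases h' : (0, j + 1) ∈ ρ <;> simp_all
  · have h1 : (i + 1, 0) ∈ ρ → (i, 0) ∈ ρ := fun h => up h (by omega) le_rfl
    by_cases h : (i, 0) ∈ ρ <;> by_cases h' : (i + 1, 0) ∈ ρ <;> simp_all
  · have h1 : (i + 1, j + 1) ∈ ρ → (i, j + 1) ∈ ρ := fun h => up h (by omega) le_rfl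
    have h2 : (i + 1, j + 1) ∈ ρ → (i + 1, j) ∈ ρ := fun h => up h le_rfl (by omega)
    have h3 : (i + 1, j) ∈ ρ → (i, j) ∈ ρ := fun h => up h (by omega) le_rfl
    have h4 : (i, j + 1) ∈ ρ → (i, j) ∈ ρ := fun h => up h le_rfl (by omega)
    by_cases h : (i, j) ∈ ρ <;> by_cases h' : (i + 1, j) ∈ ρ <;>
      by_cases h'' : (i, j + 1) ∈ ρ <;> by_cases h''' : (i + 1, j + 1) ∈ ρ <;> simp_all

/-- Summation by parts over a Young diagram: the sum of the second difference of a function of the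
content. -/
@[to_additive /-- Summation by parts over a Young diagram: the sum of the second difference of a
function of the content. -/]
theorem prod_boxes_eq_prod_corners {G : Type*} [CommMonoid G] (ρ : YoungDiagram) (φ : ℤ → G) :
    φ 0 * (∏ b ∈ ρ.cells, φ (boxContent b - 1)) * (∏ b ∈ ρ.cells, φ (boxContent b + 1))
      * ∏ b ∈ ρ.corners, φ (boxContent b)
    = (∏ b ∈ ρ.outerCorners, φ (boxContent b)) * (∏ b ∈ ρ.cells, φ (boxContent b))
      * ∏ b ∈ ρ.cells, φ (boxContent b) := by
  have h := congrArg (fun s => (s.map fun b => φ (boxContent b)).prod) ρ.boxes_eq_corners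
  simp only [Multiset.map_add, Multiset.prod_add, Finset.prod_map_val, Finset.prod_singleton] at h
  have inj : ∀ (s : Finset (ℕ × ℕ)) (k l : ℕ), ∏ b ∈ s.image (fun b => (b.1 + k, b.2 + l)),
      φ (boxContent b) = ∏ b ∈ s, φ (boxContent b + (l - k)) := by
    intro s k l
    rw [Finset.prod_image (fun a _ b _ hab => by
      simp only [Prod.mk.injEq, add_left_inj] at hab; exact Prod.ext hab.1 hab.2)]
    refine Finset.prod_congr rfl fun b _ => congrArg φ ?_
    simp only [boxContent]
    push_cast
    ring
  have h10 := inj ρ.cells 1 0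
  have h01 := inj ρ.cells 0 1
  have h11 := inj ρ.cells 1 1
  have h11' := inj ρ.corners 1 1
  simp only [add_zero, Nat.cast_one, Nat.cast_zero, zero_sub, sub_zero, sub_self] at h10 h01 h11 h11'
  rw [h10, h01, h11, h11'] at h
  simpa [boxContent, sub_eq_add_neg] using h

theorem boxContent_injOn_corners (ρ : YoungDiagram) :
    Set.InjOn (fun b => ((boxContent b : ℤ) : ℝ)) ρ.corners := by
  rintro ⟨i, j⟩ h ⟨i', j'⟩ h' e
  simp only [Finset.mem_coe, mem_corners, boxContent, Int.cast_inj] at h h' e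
  rcases lt_trichotomy i i' with hi | hi | hi
  · exact absurd (ρ.up_left_mem (by omega) (by omega) h'.1) h.2.1
  · ext <;> simp <;> omega
  · exact absurd (ρ.up_left_mem (by omega) (by omega) h.1) h'.2.1

theorem boxContent_outerCorners_ne {ρ : YoungDiagram} {b b' : ℕ × ℕ} (hb : b ∈ ρ.corners)
    (hb' : b' ∈ ρ.outerCorners) : boxContent b ≠ boxContent b' := by
  obtain ⟨i, j⟩ := b
  obtain ⟨i', j'⟩ := b'
  rw [mem_corners] at hb
  rw [mem_outerCorners] at hb'
  simp only [boxContent]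
  intro e
  rcases le_or_gt i' i with hi | hi
  · exact hb'.1 (ρ.up_left_mem hi (by omega) hb.1)
  · have := hb'.2.1 (i' - 1) (by omega)
    exact hb.2.2 (ρ.up_left_mem (by omega) (by omega) this)

end YoungDiagram

/-- An integer as a real number, with `0` replaced by `1`. -/
noncomputable def dropZero (d : ℤ) : ℝ := if d = 0 then 1 else d

/-- The factor `(d² - 1) / d²`, with the vanishing factors dropped. -/
noncomputable def contentFactor (d : ℤ) : ℝ :=
  dropZero (d - 1) * dropZero (d + 1) / dropZero d ^ 2

theorem dropZero_ne_zero (d : ℤ) : dropZero d ≠ 0 := by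
  unfold dropZero
  split_ifs with h
  · simp
  · exact_mod_cast h

theorem abs_dropZero_neg (d : ℤ) : |dropZero (-d)| = |dropZero d| := by
  by_cases h : d = 0 <;> simp [dropZero, h]

theorem contentFactor_ne_zero (d : ℤ) : contentFactor d ≠ 0 :=
  div_ne_zero (mul_ne_zero (dropZero_ne_zero _) (dropZero_ne_zero _))
    (pow_ne_zero _ (dropZero_ne_zero _))

theorem abs_contentFactor_neg (d : ℤ) : |contentFactor (-d)| = |contentFactor d| := by
  have h1 : -d - 1 = -(d + 1) := by ring
  have h2 : -d + 1 = -(d - 1) := by ring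
  simp only [contentFactor, abs_div, abs_mul, abs_pow, h1, h2, abs_dropZero_neg]
  rw [mul_comm |dropZero (d + 1)|]

theorem contentFactor_of_two_le {d : ℤ} (h : 2 ≤ |d|) :
    contentFactor d = ((d : ℝ) ^ 2 - 1) / (d : ℝ) ^ 2 := by
  have h1 : d - 1 ≠ 0 := by
    intro h'
    obtain rfl : d = 1 := by omega
    simp at h
  have h2 : d + 1 ≠ 0 := by
    intro h'
    obtain rfl : d = -1 := by omega
    simp at h
  have h3 : d ≠ 0 := by
    rintro rfl
    simp at h
  simp only [contentFactor, dropZero, h1, h2, h3, if_false]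
  push_cast
  ring

theorem contentFactor_zero : contentFactor 0 = -1 := by
  simp [contentFactor, dropZero]

namespace UpPath

variable {V : Type} {r : V → V → Prop} {a : V}

/-- A nontrivial path is a path followed by an edge. -/
def equivSigma {b : V} (h : b ≠ a) : UpPath r a b ≃ Σ c : {c // r c b}, UpPath r a c where
  toFun p := match b, p, h with
    | _, .nil, h => absurd rfl h
    | _, .snoc p h', _ => ⟨⟨_, h'⟩, p⟩
  invFun x := .snoc x.2 x.1.2
  left_inv p := by
    cases p with
    | nil => exact absurd rfl h
    | snoc p h' => rfl
  right_inv x := rfl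

theorem unique_of_minimal (h : ∀ c, ¬ r c a) : Nat.card (UpPath r a a) = 1 := by
  rw [Nat.card_eq_one_iff_unique]
  refine ⟨⟨fun p q => ?_⟩, ⟨.nil⟩⟩
  have : ∀ p : UpPath r a a, p = .nil := by
    intro p
    cases p with
    | nil => rfl
    | snoc p h' => exact absurd h' (h _)
  rw [this p, this q]

variable {rk : V → ℕ} {down : V → Finset V}

theorem finite_of_rank (hmin : ∀ c, ¬ r c a) (hrk : ∀ c b, r c b → rk b = rk c + 1)
    (hdown : ∀ c b, c ∈ down b ↔ r c b) (b : V) : Finite (UpPath r a b) := by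
  induction h : rk b generalizing b with
  | zero =>
    have : ∀ c, ¬ r c b := fun c hc => by have := hrk c b hc; omega
    rcases eq_or_ne b a with rfl | hb
    · exact Nat.finite_of_card_ne_zero (by rw [unique_of_minimal hmin]; simp)
    · have : IsEmpty {c // r c b} := ⟨fun c => this _ c.2⟩
      exact Finite.of_equiv _ (equivSigma hb).symm
  | succ n ih =>
    rcases eq_or_ne b a with rfl | hb
    · exact Nat.finite_of_card_ne_zero (by rw [unique_of_minimal hmin]; simp)
    · have : ∀ c : {c // r c b}, Finite (UpPath r a c) := fun c =>
        ih _ (by have := hrk _ _ c.2; omega)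
      have : Finite {c // r c b} := Finite.of_injective (fun c => (⟨c.1, (hdown _ _).2 c.2⟩ : down b))
        fun c d h => by simpa [Subtype.ext_iff] using h
      exact Finite.of_equiv _ (equivSigma hb).symm

theorem card_eq_sum (hmin : ∀ c, ¬ r c a) (hrk : ∀ c b, r c b → rk b = rk c + 1)
    (hdown : ∀ c b, c ∈ down b ↔ r c b) {b : V} (h : b ≠ a) :
    Nat.card (UpPath r a b) = ∑ c ∈ down b, Nat.card (UpPath r a c) := by
  have hf : ∀ c : {c // c ∈ down b}, Finite (UpPath r a c) := fun c =>
    finite_of_rank hmin hrk hdown _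
  let e : (Σ c : {c // r c b}, UpPath r a c) ≃ Σ c : {c // c ∈ down b}, UpPath r a c :=
    ⟨fun x => ⟨⟨x.1, (hdown _ _).2 x.1.2⟩, x.2⟩, fun x => ⟨⟨x.1, (hdown _ _).1 x.1.2⟩, x.2⟩,
      fun _ => rfl, fun _ => rfl⟩
  rw [Nat.card_congr ((equivSigma h).trans e), Nat.card_sigma, ← Finset.sum_coe_sort (down b)]

end UpPath

namespace YoungDiagram

/-- The diagram with a removable box removed. -/
def eraseCorner (ρ : YoungDiagram) (b : ℕ × ℕ) (hb : b ∈ ρ.corners) : YoungDiagram where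
  cells := ρ.cells.erase b
  isLowerSet := by
    obtain ⟨i, j⟩ := b
    rw [mem_corners] at hb
    rintro ⟨x, y⟩ ⟨x', y'⟩ hle h
    obtain ⟨h1, h2⟩ := Prod.mk_le_mk.mp hle
    simp only [Finset.coe_erase, Set.mem_sdiff, Finset.mem_coe, mem_cells,
      Set.mem_singleton_iff, Prod.mk.injEq, not_and] at h ⊢
    refine ⟨ρ.up_left_mem h1 h2 h.1, ?_⟩
    rintro rfl rfl
    by_cases hx : x = x'
    · exact hb.2.2 (ρ.up_left_mem h1 (by have := h.2 hx; omega) h.1)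
    · exact hb.2.1 (ρ.up_left_mem (by omega) h2 h.1)

theorem up_iff {σ ρ : YoungDiagram} :
    σ.Up ρ ↔ ∃ b ∈ ρ.corners, σ.cells = ρ.cells.erase b := by
  constructor
  · rintro ⟨hle, hcard⟩
    have hsub : σ.cells ⊆ ρ.cells := hle
    obtain ⟨b, hb⟩ := Finset.card_eq_one.mp
      (show (ρ.cells \ σ.cells).card = 1 by
        rw [Finset.card_sdiff_of_subset hsub]
        simp only [YoungDiagram.card] at hcard
        omega)
    have hmem : ∀ x, x ∈ ρ → x ≠ b → x ∈ σ := by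
      intro x hx hxb
      by_contra hxσ
      have : x ∈ ρ.cells \ σ.cells := Finset.mem_sdiff.2 ⟨hx, hxσ⟩
      rw [hb, Finset.mem_singleton] at this
      exact hxb this
    have hbm := Finset.mem_sdiff.1 (hb ▸ Finset.mem_singleton_self b)
    refine ⟨b, ?_, ?_⟩
    · obtain ⟨i, j⟩ := b
      rw [mem_corners]
      refine ⟨hbm.1, fun h => hbm.2 ?_, fun h => hbm.2 ?_⟩
      · exact σ.up_left_mem (Nat.le_succ i) le_rfl (hmem _ h (by simp))
      · exact σ.up_left_mem le_rfl (Nat.le_succ j) (hmem _ h (by simp))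
    · ext x
      rw [Finset.mem_erase]
      exact ⟨fun h => ⟨fun e => hbm.2 (e ▸ h), hsub h⟩, fun h => hmem x h.2 h.1⟩
  · rintro ⟨b, hb, h⟩
    have hbρ : b ∈ ρ.cells := (Finset.mem_filter.1 hb).1
    refine ⟨cells_subset_iff.1 (h ▸ Finset.erase_subset _ _), ?_⟩
    simp only [YoungDiagram.card, h, Finset.card_erase_of_mem hbρ]
    have := Finset.card_pos.2 ⟨b, hbρ⟩
    omega

theorem addedContent_of_cells_eq {σ ρ : YoungDiagram} {b : ℕ × ℕ} (hb : b ∈ ρ.cells)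
    (h : σ.cells = ρ.cells.erase b) : σ.addedContent ρ = boxContent b := by
  rw [addedContent, h, Finset.sdiff_erase hb, Finset.sdiff_self]
  simp

theorem finite_up (ρ : YoungDiagram) : {σ : YoungDiagram | σ.Up ρ}.Finite := by
  refine Set.Finite.of_finite_image (f := YoungDiagram.cells)
    (ρ.cells.powerset.finite_toSet.subset ?_) fun σ _ τ _ h => YoungDiagram.ext h
  rintro _ ⟨σ, hσ, rfl⟩
  simpa using hσ.1

/-- The diagrams from which `ρ` is obtained by adding one box. -/
noncomputable def down (ρ : YoungDiagram) : Finset YoungDiagram := ρ.finite_up.toFinset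

theorem mem_down {σ ρ : YoungDiagram} : σ ∈ ρ.down ↔ σ.Up ρ := by
  simp [down]

theorem not_up_bot (σ : YoungDiagram) : ¬ σ.Up ⊥ := fun h => by
  have := h.2
  simp [YoungDiagram.card] at this

theorem pathCount_bot : (⊥ : YoungDiagram).pathCount = 1 :=
  UpPath.unique_of_minimal not_up_bot

theorem pathCount_eq_sum {ρ : YoungDiagram} (h : ρ ≠ ⊥) :
    ρ.pathCount = ∑ σ ∈ ρ.down, σ.pathCount :=
  UpPath.card_eq_sum (rk := YoungDiagram.card) not_up_bot (fun _ _ h => h.2)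
    (fun _ _ => mem_down) h

theorem sum_down_eq_sum_corners (ρ : YoungDiagram) (F : YoungDiagram → ℝ) :
    ∑ σ ∈ ρ.down, F σ = ∑ b ∈ ρ.corners.attach, F (ρ.eraseCorner b b.2) := by
  symm
  refine Finset.sum_bij (fun b _ => ρ.eraseCorner b b.2) ?_ ?_ ?_ fun _ _ => rfl
  · exact fun b _ => mem_down.2 (up_iff.2 ⟨b, b.2, rfl⟩)
  · intro b _ b' _ h
    have hc : ρ.cells.erase b = ρ.cells.erase b' := congrArg YoungDiagram.cells h
    by_contra hne
    have hb : (b : ℕ × ℕ) ∈ ρ.cells.erase b' :=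
      Finset.mem_erase.2 ⟨fun e => hne (Subtype.ext e), (Finset.mem_filter.1 b.2).1⟩
    rw [← hc] at hb
    exact Finset.notMem_erase _ _ hb
  · intro σ hσ
    obtain ⟨b, hb, h⟩ := up_iff.1 (mem_down.1 hσ)
    exact ⟨⟨b, hb⟩, Finset.mem_attach _ _, YoungDiagram.ext h.symm⟩

/-- The reciprocal of the residue at `c` of the Cauchy transform of the transition measure. -/
noncomputable def weight (σ : YoungDiagram) (c : ℤ) : ℝ :=
  dropZero c * ∏ b ∈ σ.cells, contentFactor (c - boxContent b)

theorem weight_ne_zero (σ : YoungDiagram) (c : ℤ) : σ.weight c ≠ 0 :=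
  mul_ne_zero (dropZero_ne_zero _) (Finset.prod_ne_zero_iff.2 fun _ _ => contentFactor_ne_zero _)

theorem weight_of_cells_eq {σ ρ : YoungDiagram} {b : ℕ × ℕ} (hb : b ∈ ρ.cells)
    (h : σ.cells = ρ.cells.erase b) (c : ℤ) :
    ρ.weight c = σ.weight c * contentFactor (c - boxContent b) := by
  rw [weight, weight, h, ← Finset.mul_prod_erase _ _ hb]
  ring

theorem weight_eq_residue {ρ : YoungDiagram} {b : ℕ × ℕ} (hb : b ∈ ρ.corners) :
    (ρ.eraseCorner b hb).weight (boxContent b)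
      = -((∏ x ∈ ρ.outerCorners, ((boxContent b : ℝ) - boxContent x))
        / ∏ y ∈ ρ.corners.erase b, ((boxContent b : ℝ) - boxContent y)) := by
  have hbρ : b ∈ ρ.cells := (Finset.mem_filter.1 hb).1
  set c := boxContent b with hc
  have h1 := weight_of_cells_eq (σ := ρ.eraseCorner b hb) hbρ rfl c
  rw [← hc, sub_self, contentFactor_zero] at h1
  have h2 := ρ.prod_boxes_eq_prod_corners fun k => dropZero (c - k)
  have h3 : ∏ x ∈ ρ.outerCorners, dropZero (c - boxContent x)
      = ∏ x ∈ ρ.outerCorners, ((c : ℝ) - boxContent x) := by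
    refine Finset.prod_congr rfl fun x hx => ?_
    rw [dropZero, if_neg (sub_ne_zero.2 (boxContent_outerCorners_ne hb hx))]
    push_cast
    rfl
  have h4 : ∏ x ∈ ρ.corners, dropZero (c - boxContent x)
      = ∏ x ∈ ρ.corners.erase b, ((c : ℝ) - boxContent x) := by
    rw [← Finset.mul_prod_erase _ _ hb, ← hc, sub_self, dropZero, if_pos rfl, one_mul]
    refine Finset.prod_congr rfl fun x hx => ?_
    rw [Finset.mem_erase] at hx
    have : c - boxContent x ≠ 0 := by
      rw [sub_ne_zero]
      intro e
      exact hx.1 (ρ.boxContent_injOn_corners hx.2 hb (by simp only [← hc, e]))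
    rw [dropZero, if_neg this]
    push_cast
    rfl
  have h5 : ∏ x ∈ ρ.corners.erase b, ((c : ℝ) - boxContent x) ≠ 0 := by
    rw [← h4]
    exact Finset.prod_ne_zero_iff.2 fun _ _ => dropZero_ne_zero _
  have h6 : ∏ x ∈ ρ.cells, dropZero (c - boxContent x) ≠ 0 :=
    Finset.prod_ne_zero_iff.2 fun _ _ => dropZero_ne_zero _
  simp only [h3, h4, sub_zero] at h2
  have h7 : ρ.weight c = dropZero c * ((∏ x ∈ ρ.cells, dropZero (c - (boxContent x + 1)))
      * (∏ x ∈ ρ.cells, dropZero (c - (boxContent x - 1)))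
      / (∏ x ∈ ρ.cells, dropZero (c - boxContent x)) ^ 2) := by
    rw [weight, ← Finset.prod_pow, ← Finset.prod_mul_distrib, ← Finset.prod_div_distrib]
    congr 1
    refine Finset.prod_congr rfl fun x _ => ?_
    rw [contentFactor]
    rw [show c - boxContent x - 1 = c - (boxContent x + 1) by ring,
      show c - boxContent x + 1 = c - (boxContent x - 1) by ring]
  have h8 : (ρ.eraseCorner b hb).weight c = -ρ.weight c := by linarith
  rw [h8, h7, neg_inj, eq_div_iff h5]
  field_simp
  linear_combination h2

theorem sum_weight (ρ : YoungDiagram) :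
    ∑ σ ∈ ρ.down, σ.weight (σ.addedContent ρ) = ρ.card := by
  have h0 := ρ.sum_boxes_eq_sum_corners fun _ => 1
  have h1 := ρ.sum_boxes_eq_sum_corners fun k => (k : ℝ)
  have h2 := ρ.sum_boxes_eq_sum_corners fun k => (k : ℝ) ^ 2
  simp only [Finset.sum_const, smul_eq_mul, mul_one] at h0
  push_cast at h1 h2
  simp only [Finset.sum_add_distrib, Finset.sum_sub_distrib, add_sq, sub_sq, Finset.sum_const,
    nsmul_eq_mul, mul_one, one_pow, ← Finset.mul_sum] at h1 h2
  have hres := sum_residues_eq (s := ρ.outerCorners) ρ.boxContent_injOn_corners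
    (by omega) (by linarith)
  rw [sum_down_eq_sum_corners]
  have : ∀ b ∈ ρ.corners.attach, (ρ.eraseCorner b b.2).weight ((ρ.eraseCorner b b.2).addedContent ρ)
      = -((∏ x ∈ ρ.outerCorners, ((boxContent b : ℝ) - boxContent x))
        / ∏ y ∈ ρ.corners.erase b, ((boxContent b : ℝ) - boxContent y)) := fun b _ => by
    rw [addedContent_of_cells_eq (b := b) (Finset.mem_filter.1 b.2).1 rfl, weight_eq_residue]
  rw [Finset.sum_congr rfl this, Finset.sum_attach ρ.corners fun b : ℕ × ℕ =>
    -((∏ x ∈ ρ.outerCorners, ((boxContent b : ℝ) - boxContent x))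
        / ∏ y ∈ ρ.corners.erase b, ((boxContent b : ℝ) - boxContent y)), Finset.sum_neg_distrib,
    hres, YoungDiagram.card]
  linarith

theorem two_le_abs_sub {ρ : YoungDiagram} {b b' : ℕ × ℕ} (hb : b ∈ ρ.corners)
    (hb' : b' ∈ ρ.corners) (h : b ≠ b') : 2 ≤ |boxContent b - boxContent b'| := by
  obtain ⟨i, j⟩ := b
  obtain ⟨i', j'⟩ := b'
  rw [mem_corners] at hb hb'
  simp only [boxContent]
  have h1 : ¬ (i + 1 ≤ i' ∧ j ≤ j') := fun h => hb.2.1 (ρ.up_left_mem h.1 h.2 hb'.1)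
  have h2 : ¬ (i ≤ i' ∧ j + 1 ≤ j') := fun h => hb.2.2 (ρ.up_left_mem h.1 h.2 hb'.1)
  have h3 : ¬ (i' + 1 ≤ i ∧ j' ≤ j) := fun h => hb'.2.1 (ρ.up_left_mem h.1 h.2 hb.1)
  have h4 : ¬ (i' ≤ i ∧ j' + 1 ≤ j) := fun h => hb'.2.2 (ρ.up_left_mem h.1 h.2 hb.1)
  have h5 : ¬ (i = i' ∧ j = j') := fun e => h (by rw [e.1, e.2])
  rw [le_abs]
  omega

/-- Two different diagrams below `ρ` cover a common diagram, and the weights of the two paths from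
it to `ρ` agree. -/
theorem exists_weight_mul_eq {ρ σ σ' : YoungDiagram} (h : σ.Up ρ) (h' : σ'.Up ρ) (hne : σ ≠ σ') :
    ∃ τ : YoungDiagram, τ.Up σ ∧ τ.Up σ' ∧
      τ.weight (τ.addedContent σ) * σ.weight (σ.addedContent ρ)
        = τ.weight (τ.addedContent σ') * σ'.weight (σ'.addedContent ρ) := by
  obtain ⟨b, hb, e⟩ := up_iff.1 h
  obtain ⟨b', hb', e'⟩ := up_iff.1 h'
  have hbρ : b ∈ ρ.cells := (Finset.mem_filter.1 hb).1
  have hbρ' : b' ∈ ρ.cells := (Finset.mem_filter.1 hb').1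
  have hbb : b ≠ b' := by
    rintro rfl
    exact hne (YoungDiagram.ext (e.trans e'.symm))
  have hbσ : b' ∈ σ.cells := by rw [e]; exact Finset.mem_erase.2 ⟨hbb.symm, hbρ'⟩
  have hbσ' : b ∈ σ'.cells := by rw [e']; exact Finset.mem_erase.2 ⟨hbb, hbρ⟩
  have c1 : (σ ⊓ σ').cells = σ.cells.erase b' := by
    ext x
    simp only [cells_inf, e, e', Finset.mem_inter, Finset.mem_erase]
    tauto
  have c2 : (σ ⊓ σ').cells = σ'.cells.erase b := by
    ext x
    simp only [cells_inf, e, e', Finset.mem_inter, Finset.mem_erase]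
    tauto
  have hcard : ∀ {τ : YoungDiagram} {x}, x ∈ τ.cells → (σ ⊓ σ').cells = τ.cells.erase x →
      (σ ⊓ σ').Up τ := fun {τ x} hx hc => by
    refine ⟨cells_subset_iff.1 (hc ▸ Finset.erase_subset _ _), ?_⟩
    simp only [YoungDiagram.card, hc, Finset.card_erase_of_mem hx]
    have := Finset.card_pos.2 ⟨x, hx⟩
    omega
  refine ⟨σ ⊓ σ', hcard hbσ c1, hcard hbσ' c2, ?_⟩
  rw [addedContent_of_cells_eq hbσ c1, addedContent_of_cells_eq hbσ' c2,
    addedContent_of_cells_eq hbρ e, addedContent_of_cells_eq hbρ' e',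
    weight_of_cells_eq hbσ c1, weight_of_cells_eq hbσ' c2,
    contentFactor_of_two_le (two_le_abs_sub hb hb' hbb),
    contentFactor_of_two_le (two_le_abs_sub hb' hb hbb.symm)]
  push_cast
  rw [← neg_sub (boxContent b : ℝ), neg_sq]
  ring

/-- The cotransition probabilities of the Young graph are the weights divided by the number of
boxes. -/
theorem card_mul_pathCount {ρ σ : YoungDiagram} (h : σ.Up ρ) :
    (ρ.card : ℝ) * σ.pathCount = ρ.pathCount * σ.weight (σ.addedContent ρ) := by
  induction hn : ρ.card generalizing ρ σ with
  | zero =>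
    have := h.2
    omega
  | succ n ih =>
    have hρ : ρ ≠ ⊥ := by
      rintro rfl
      exact not_up_bot _ h
    have key : ∀ σ' ∈ ρ.down, (σ'.pathCount : ℝ) * σ.weight (σ.addedContent ρ)
        = σ.pathCount * σ'.weight (σ'.addedContent ρ) := by
      intro σ' hσ'
      rw [mem_down] at hσ'
      rcases eq_or_ne σ σ' with rfl | hne
      · rfl
      obtain ⟨τ, h1, h2, h3⟩ := exists_weight_mul_eq h hσ' hne
      have e1 := ih h1 (by have := h.2; omega)
      have e2 := ih h2 (by have := hσ'.2; omega)
      apply mul_left_cancel₀ (τ.weight_ne_zero (τ.addedContent σ))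
      linear_combination (σ'.pathCount : ℝ) * h3 +
        σ'.weight (σ'.addedContent ρ) * (e1 - e2)
    rw [pathCount_eq_sum hρ]
    push_cast
    rw [Finset.sum_mul, Finset.sum_congr rfl key, ← Finset.mul_sum, sum_weight, hn]
    push_cast
    ring

theorem exists_up_of_ne_bot {ρ : YoungDiagram} (h : ρ ≠ ⊥) : ∃ σ : YoungDiagram, σ.Up ρ := by
  by_contra hn
  have : ρ.down = ∅ := Finset.eq_empty_of_forall_notMem fun σ hσ => hn ⟨σ, mem_down.1 hσ⟩
  have hs := sum_weight ρ
  rw [this, Finset.sum_empty] at hs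
  have hc : ρ.cells = ∅ := Finset.card_eq_zero.1 (by exact_mod_cast hs.symm)
  exact h (YoungDiagram.ext hc)

theorem pathCount_pos (ρ : YoungDiagram) : 0 < ρ.pathCount := by
  induction hn : ρ.card generalizing ρ with
  | zero =>
    have : ρ = ⊥ := YoungDiagram.ext (Finset.card_eq_zero.1 hn)
    rw [this, pathCount_bot]
    exact one_pos
  | succ n ih =>
    have hρ : ρ ≠ ⊥ := by
      rintro rfl
      simp [YoungDiagram.card] at hn
    obtain ⟨σ, hσ⟩ := exists_up_of_ne_bot hρ
    rw [pathCount_eq_sum hρ]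
    exact Finset.sum_pos (fun σ hσ => ih σ (by have := (mem_down.1 hσ).2; omega))
      ⟨σ, mem_down.2 hσ⟩

theorem weight_pos {ρ σ : YoungDiagram} (h : σ.Up ρ) : 0 < σ.weight (σ.addedContent ρ) := by
  have h1 := card_mul_pathCount h
  have h2 : (0 : ℝ) < ρ.pathCount := by exact_mod_cast ρ.pathCount_pos
  have h3 : (0 : ℝ) < σ.pathCount := by exact_mod_cast σ.pathCount_pos
  have h4 : (0 : ℝ) < ρ.card := by
    rw [h.2]
    positivity
  have : 0 < ρ.pathCount * σ.weight (σ.addedContent ρ) := h1 ▸ mul_pos h4 h3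
  exact (pos_iff_pos_of_mul_pos this).1 h2

/-- The number of paths to `ρ` divided by `|ρ|!`. -/
noncomputable def normCount (ρ : YoungDiagram) : ℝ := ρ.pathCount / (ρ.card.factorial : ℝ)

theorem normCount_pos (ρ : YoungDiagram) : 0 < ρ.normCount :=
  div_pos (by exact_mod_cast ρ.pathCount_pos) (by exact_mod_cast Nat.factorial_pos _)

theorem normCount_eq_mul_abs_weight {ρ σ : YoungDiagram} (h : σ.Up ρ) :
    σ.normCount = ρ.normCount * |σ.weight (σ.addedContent ρ)| := by
  have h1 := card_mul_pathCount h
  rw [abs_of_pos (weight_pos h), normCount, normCount, h.2, Nat.factorial_succ]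
  rw [h.2] at h1
  have := Nat.factorial_ne_zero σ.card
  push_cast at h1 ⊢
  field_simp
  linear_combination h1

theorem sum_normCount_down (ρ : YoungDiagram) :
    ∑ σ ∈ ρ.down, σ.normCount = ρ.card * ρ.normCount := by
  have hs := sum_weight ρ
  rw [Finset.sum_congr rfl fun σ hσ => normCount_eq_mul_abs_weight (mem_down.1 hσ),
    ← Finset.mul_sum, Finset.sum_congr rfl fun σ hσ => abs_of_pos (weight_pos (mem_down.1 hσ)),
    hs, mul_comm]

theorem plancherelUp_eq {ρ σ : YoungDiagram} (h : σ.Up ρ) :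
    σ.plancherelUp ρ = ρ.normCount / σ.normCount := by
  rw [plancherelUp, if_pos h, normCount, normCount, h.2, Nat.factorial_succ]
  have := Nat.factorial_ne_zero σ.card
  have h3 : (σ.pathCount : ℝ) ≠ 0 := by exact_mod_cast σ.pathCount_pos.ne'
  push_cast
  field_simp

end YoungDiagram

namespace YoungDiagram

/-- The boxes of `ρ` above the diagonal, moved one step to the left. -/
def aboveDiag (ρ : YoungDiagram) : Finset (ℕ × ℕ) :=
  (ρ.cells.filter fun b => b.1 < b.2).image fun b => (b.1, b.2 - 1)

/-- The transposes of the boxes of `ρ` weakly below the diagonal. -/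
def belowDiag (ρ : YoungDiagram) : Finset (ℕ × ℕ) :=
  (ρ.cells.filter fun b => ¬ b.1 < b.2).image Prod.swap

theorem mem_aboveDiag {ρ : YoungDiagram} {i j : ℕ} :
    (i, j) ∈ ρ.aboveDiag ↔ i ≤ j ∧ (i, j + 1) ∈ ρ := by
  simp only [aboveDiag, Finset.mem_image, Finset.mem_filter, mem_cells, Prod.exists,
    Prod.mk.injEq]
  constructor
  · rintro ⟨a, b, ⟨h, hab⟩, rfl, rfl⟩
    exact ⟨by omega, by rwa [Nat.sub_add_cancel (by omega)]⟩
  · rintro ⟨h, hm⟩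
    exact ⟨i, j + 1, ⟨hm, by omega⟩, rfl, rfl⟩

theorem mem_belowDiag {ρ : YoungDiagram} {i j : ℕ} :
    (i, j) ∈ ρ.belowDiag ↔ i ≤ j ∧ (j, i) ∈ ρ := by
  simp only [belowDiag, Finset.mem_image, Finset.mem_filter, mem_cells, Prod.exists,
    Prod.swap_prod_mk, Prod.mk.injEq, not_lt]
  constructor
  · rintro ⟨a, b, ⟨h, hab⟩, rfl, rfl⟩
    exact ⟨hab, h⟩
  · rintro ⟨h, hm⟩
    exact ⟨j, i, ⟨hm, h⟩, rfl, rfl⟩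

theorem card_aboveDiag_add_card_belowDiag (ρ : YoungDiagram) :
    ρ.aboveDiag.card + ρ.belowDiag.card = ρ.card := by
  rw [aboveDiag, belowDiag, Finset.card_image_of_injOn,
    Finset.card_image_of_injective _ Prod.swap_injective,
    Finset.card_filter_add_card_filter_not, YoungDiagram.card]
  rintro ⟨a, b⟩ h ⟨a', b'⟩ h' e
  simp only [Finset.coe_filter, Set.mem_ofPred_eq, Prod.mk.injEq] at h h' e ⊢
  omega

/-- The smallest shifted diagram whose doubling contains `ρ`. -/
def upperHalf (ρ : YoungDiagram) : ShiftedDiagram where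
  cells := ρ.aboveDiag ∪ ρ.belowDiag
  le_of_mem := by
    rintro ⟨i, j⟩ h
    rw [Finset.mem_union, mem_aboveDiag, mem_belowDiag] at h
    exact h.elim And.left And.left
  closed := by
    rintro ⟨i, j⟩ h ⟨i', j'⟩ hle hi hj
    simp only [Finset.mem_union, mem_aboveDiag, mem_belowDiag] at h hle hi hj ⊢
    refine h.imp (fun h => ⟨hle, ?_⟩) fun h => ⟨hle, ?_⟩
    · exact ρ.up_left_mem hi (by omega) h.2
    · exact ρ.up_left_mem hj hi h.2

/-- The largest shifted diagram whose doubling is contained in `ρ`. -/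
def lowerHalf (ρ : YoungDiagram) : ShiftedDiagram where
  cells := ρ.aboveDiag ∩ ρ.belowDiag
  le_of_mem := by
    rintro ⟨i, j⟩ h
    rw [Finset.mem_inter, mem_aboveDiag] at h
    exact h.1.1
  closed := by
    rintro ⟨i, j⟩ h ⟨i', j'⟩ hle hi hj
    simp only [Finset.mem_inter, mem_aboveDiag, mem_belowDiag] at h hle hi hj ⊢
    exact ⟨⟨hle, ρ.up_left_mem hi (by omega) h.1.2⟩, hle, ρ.up_left_mem hj hi h.2.2⟩

theorem card_upperHalf_add_card_lowerHalf (ρ : YoungDiagram) :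
    ρ.upperHalf.card + ρ.lowerHalf.card = ρ.card :=
  (Finset.card_union_add_card_inter _ _).trans ρ.card_aboveDiag_add_card_belowDiag

theorem lowerHalf_subset_upperHalf (ρ : YoungDiagram) :
    ρ.lowerHalf.cells ⊆ ρ.upperHalf.cells :=
  Finset.inter_subset_left.trans Finset.subset_union_left

theorem le_doubling_iff {ρ : YoungDiagram} {lam : ShiftedDiagram} :
    ρ ≤ lam.doubling ↔ ρ.upperHalf.cells ⊆ lam.cells := by
  constructor
  · rintro h ⟨i, j⟩ hm
    rw [upperHalf, Finset.mem_union, mem_aboveDiag, mem_belowDiag] at hm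
    rcases hm with ⟨hle, hm⟩ | ⟨hle, hm⟩
    · have := h hm
      simp only [ShiftedDiagram.mem_doubling, Nat.add_sub_cancel] at this
      exact this.elim And.right fun h => absurd h.1 (by omega)
    · have := h hm
      simp only [ShiftedDiagram.mem_doubling] at this
      exact this.elim (fun h => absurd h.1 (by omega)) And.right
  · rintro h ⟨a, b⟩ hm
    simp only [ShiftedDiagram.mem_doubling] at hm ⊢
    rcases lt_or_ge a b with hab | hab
    · refine Or.inl ⟨hab, h (Finset.mem_union_left _ (mem_aboveDiag.2 ⟨by omega, ?_⟩))⟩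
      rwa [Nat.sub_add_cancel (by omega)]
    · exact Or.inr ⟨hab, h (Finset.mem_union_right _ (mem_belowDiag.2 ⟨hab, hm⟩))⟩

theorem doubling_le_iff {ρ : YoungDiagram} {mu : ShiftedDiagram} :
    mu.doubling ≤ ρ ↔ mu.cells ⊆ ρ.lowerHalf.cells := by
  constructor
  · rintro h ⟨i, j⟩ hm
    have hij : i ≤ j := mu.le_of_mem _ hm
    rw [lowerHalf, Finset.mem_inter, mem_aboveDiag, mem_belowDiag]
    refine ⟨⟨hij, h ?_⟩, hij, h ?_⟩
    · simp only [ShiftedDiagram.mem_doubling]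
      exact Or.inl ⟨by omega, hm⟩
    · simp only [ShiftedDiagram.mem_doubling]
      exact Or.inr ⟨hij, hm⟩
  · rintro h ⟨a, b⟩ hm
    simp only [ShiftedDiagram.mem_doubling] at hm ⊢
    rcases hm with ⟨hab, hm⟩ | ⟨hab, hm⟩
    · have := (mem_aboveDiag.1 (Finset.mem_inter.1 (h hm)).1).2
      rwa [Nat.sub_add_cancel (by omega)] at this
    · exact (mem_belowDiag.1 (Finset.mem_inter.1 (h hm)).2).2

end YoungDiagram

namespace ShiftedDiagram

theorem disjoint_doubling_cells (lam : ShiftedDiagram) :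
    Disjoint (lam.cells.image fun c => (c.1, c.2 + 1)) (lam.cells.image fun c => (c.2, c.1)) := by
  rw [Finset.disjoint_left]
  intro x hx hx'
  obtain ⟨c, hc, rfl⟩ := Finset.mem_image.1 hx
  obtain ⟨d, hd, e⟩ := Finset.mem_image.1 hx'
  simp only [Prod.mk.injEq] at e
  have := lam.le_of_mem _ hc
  have := lam.le_of_mem _ hd
  omega

theorem prod_doubling {G : Type*} [CommMonoid G] (lam : ShiftedDiagram) (φ : ℤ → G) :
    ∏ b ∈ lam.doubling.cells, φ (boxContent b)
      = ∏ b ∈ lam.cells, φ (boxContent b + 1) * φ (-boxContent b) := by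
  rw [doubling, Finset.prod_union lam.disjoint_doubling_cells, Finset.prod_image, Finset.prod_image,
    Finset.prod_mul_distrib]
  · congr 1 <;> refine Finset.prod_congr rfl fun b _ => congrArg φ ?_ <;>
      simp only [boxContent] <;> push_cast <;> ring
  · exact fun a _ b _ h => by simp only [Prod.mk.injEq] at h; exact Prod.ext h.2 h.1
  · exact fun a _ b _ h => by simp only [Prod.mk.injEq, add_left_inj] at h; exact Prod.ext h.1 h.2

theorem card_doubling (lam : ShiftedDiagram) : lam.doubling.card = 2 * lam.card := by
  rw [YoungDiagram.card, doubling, Finset.card_union_of_disjoint lam.disjoint_doubling_cells,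
    Finset.card_image_of_injective, Finset.card_image_of_injective, card, two_mul]
  · exact fun a b h => by simp only [Prod.mk.injEq] at h; exact Prod.ext h.2 h.1
  · exact fun a b h => by simp only [Prod.mk.injEq, add_left_inj] at h; exact Prod.ext h.1 h.2

theorem upperHalf_doubling (lam : ShiftedDiagram) : lam.doubling.upperHalf = lam := by
  have h1 := YoungDiagram.le_doubling_iff.1 (le_refl lam.doubling)
  have h2 := YoungDiagram.doubling_le_iff.1 (le_refl lam.doubling)
  exact ShiftedDiagram.ext
    (h1.antisymm (h2.trans lam.doubling.lowerHalf_subset_upperHalf))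

theorem doubling_injective : Function.Injective doubling := fun lam mu h => by
  rw [← upperHalf_doubling lam, h, upperHalf_doubling]

theorem lowerHalf_eq_of_up {mu : ShiftedDiagram} {ρ : YoungDiagram} (h : mu.doubling.Up ρ) :
    ρ.lowerHalf = mu ∧ ρ.upperHalf.card = mu.card + 1 := by
  have h1 := YoungDiagram.doubling_le_iff.1 h.1
  have h2 := Finset.card_le_card h1
  have h3 := Finset.card_le_card ρ.lowerHalf_subset_upperHalf
  have h4 := ρ.card_upperHalf_add_card_lowerHalf
  have h5 := h.2
  rw [card_doubling] at h5
  unfold card at *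
  refine ⟨ShiftedDiagram.ext (Finset.eq_of_subset_of_card_le h1 ?_).symm, ?_⟩ <;> omega

theorem upperHalf_eq_of_up {lam : ShiftedDiagram} {ρ : YoungDiagram} (h : ρ.Up lam.doubling) :
    ρ.upperHalf = lam ∧ lam.card = ρ.lowerHalf.card + 1 := by
  have h1 := YoungDiagram.le_doubling_iff.1 h.1
  have h2 := Finset.card_le_card h1
  have h3 := Finset.card_le_card ρ.lowerHalf_subset_upperHalf
  have h4 := ρ.card_upperHalf_add_card_lowerHalf
  have h5 := h.2
  rw [card_doubling] at h5
  unfold card at *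
  refine ⟨ShiftedDiagram.ext (Finset.eq_of_subset_of_card_le h1 ?_), ?_⟩ <;> omega

theorem up_doubling_upperHalf {mu : ShiftedDiagram} {ρ : YoungDiagram} (h : mu.doubling.Up ρ) :
    ρ.Up ρ.upperHalf.doubling := by
  refine ⟨YoungDiagram.le_doubling_iff.2 subset_rfl, ?_⟩
  rw [card_doubling, (lowerHalf_eq_of_up h).2, h.2, card_doubling]
  ring

theorem doubling_lowerHalf_up {lam : ShiftedDiagram} {ρ : YoungDiagram} (h : ρ.Up lam.doubling) :
    ρ.lowerHalf.doubling.Up ρ := by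
  refine ⟨YoungDiagram.doubling_le_iff.2 subset_rfl, ?_⟩
  have h1 := h.2
  rw [card_doubling, (upperHalf_eq_of_up h).2] at h1
  rw [card_doubling]
  omega

theorem lowerHalf_up {lam : ShiftedDiagram} {ρ : YoungDiagram} (h : ρ.Up lam.doubling) :
    ρ.lowerHalf.Up lam := by
  have h1 := upperHalf_eq_of_up h
  have h2 := ρ.lowerHalf_subset_upperHalf
  rw [h1.1] at h2
  exact ⟨h2, h1.2⟩

theorem existsUnique_forced {mu : ShiftedDiagram} {ρ : YoungDiagram} (h : mu.doubling.Up ρ) :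
    ∃! τ : YoungDiagram, ρ.Up τ ∧ τ.DSymmetric := by
  refine ⟨ρ.upperHalf.doubling, ⟨up_doubling_upperHalf h, _, rfl⟩, ?_⟩
  rintro _ ⟨h', lam, rfl⟩
  rw [(upperHalf_eq_of_up h').1]

theorem finite_up (lam : ShiftedDiagram) : {mu : ShiftedDiagram | mu.Up lam}.Finite := by
  refine Set.Finite.of_finite_image (f := ShiftedDiagram.cells)
    (lam.cells.powerset.finite_toSet.subset ?_) fun σ _ τ _ h => ShiftedDiagram.ext h
  rintro _ ⟨σ, hσ, rfl⟩
  simpa using hσ.1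

/-- The shifted diagrams from which `lam` is obtained by adding one box. -/
noncomputable def down (lam : ShiftedDiagram) : Finset ShiftedDiagram := lam.finite_up.toFinset

theorem mem_down {mu lam : ShiftedDiagram} : mu ∈ lam.down ↔ mu.Up lam := by
  simp [down]

theorem not_up_empty (mu : ShiftedDiagram) : ¬ mu.Up empty := fun h => by
  have := h.2
  simp [card, empty] at this

theorem pathCount_empty : empty.pathCount = 1 :=
  UpPath.unique_of_minimal not_up_empty

theorem pathCount_eq_sum {lam : ShiftedDiagram} (h : lam ≠ empty) :
    lam.pathCount = ∑ mu ∈ lam.down, mu.pathCount :=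
  UpPath.card_eq_sum (rk := card) not_up_empty (fun _ _ h => h.2) (fun _ _ => mem_down) h

theorem eq_empty_of_card_eq_zero {lam : ShiftedDiagram} (h : lam.card = 0) : lam = empty :=
  ShiftedDiagram.ext (Finset.card_eq_zero.1 h)

theorem doubling_empty : empty.doubling = ⊥ := by
  ext
  simp [doubling, empty]

open Classical in
/-- The ordinary diagrams between the doublings of `mu` and of `lam`. -/
noncomputable def between (mu lam : ShiftedDiagram) : Finset YoungDiagram :=
  lam.doubling.down.filter fun ρ => mu.doubling.Up ρ

theorem mem_between {mu lam : ShiftedDiagram} {ρ : YoungDiagram} :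
    ρ ∈ between mu lam ↔ mu.doubling.Up ρ ∧ ρ.Up lam.doubling := by
  classical
  rw [between, Finset.mem_filter, YoungDiagram.mem_down, and_comm]

theorem sum_down_doubling {G : Type*} [AddCommMonoid G] (lam : ShiftedDiagram)
    (F : YoungDiagram → G) :
    ∑ ρ ∈ lam.doubling.down, F ρ = ∑ mu ∈ lam.down, ∑ ρ ∈ between mu lam, F ρ := by
  classical
  rw [← Finset.sum_fiberwise_of_maps_to (g := YoungDiagram.lowerHalf) (t := lam.down)
    fun ρ hρ => mem_down.2 (lowerHalf_up (YoungDiagram.mem_down.1 hρ))]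
  refine Finset.sum_congr rfl fun mu _ => Finset.sum_congr ?_ fun _ _ => rfl
  ext ρ
  rw [Finset.mem_filter, mem_between, YoungDiagram.mem_down, and_comm, and_congr_left_iff]
  intro h
  constructor
  · rintro rfl
    exact doubling_lowerHalf_up h
  · exact fun h => (lowerHalf_eq_of_up h).1

theorem exists_box_of_up {mu lam : ShiftedDiagram} (h : mu.Up lam) :
    ∃ i j, i ≤ j ∧ (i, j) ∉ mu.cells ∧ lam.cells = insert (i, j) mu.cells := by
  obtain ⟨⟨i, j⟩, hb⟩ := Finset.card_eq_one.mp
    (show (lam.cells \ mu.cells).card = 1 by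
      have := h.2
      rw [Finset.card_sdiff_of_subset h.1]
      simp only [card] at this
      omega)
  have hm := Finset.mem_sdiff.1 (hb ▸ Finset.mem_singleton_self (i, j))
  refine ⟨i, j, lam.le_of_mem _ hm.1, hm.2, ?_⟩
  rw [← Finset.sdiff_union_of_subset h.1, hb]
  rfl

section Box

variable {mu lam : ShiftedDiagram} {i j : ℕ}

theorem addedContent_of_cells_eq (hn : (i, j) ∉ mu.cells)
    (h : lam.cells = insert (i, j) mu.cells) : mu.addedContent lam = (j : ℤ) - i := by
  rw [addedContent, h, Finset.insert_sdiff_of_notMem _ hn, Finset.sdiff_self]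
  simp [boxContent]

theorem length_of_lt (hij : i < j) (h : lam.cells = insert (i, j) mu.cells) :
    lam.length = mu.length := by
  have hi : (i, i) ∈ lam.cells :=
    lam.closed (i, j) (by rw [h]; simp) _ le_rfl le_rfl hij.le
  rw [h, Finset.mem_insert] at hi
  rw [length, h, Finset.image_insert, Finset.insert_eq_of_mem, length]
  exact Finset.mem_image.2 ⟨(i, i), hi.resolve_left (by simp; omega), rfl⟩

theorem length_of_eq (hn : (i, i) ∉ mu.cells) (h : lam.cells = insert (i, i) mu.cells) :
    lam.length = mu.length + 1 := by
  rw [length, h, Finset.image_insert, Finset.card_insert_of_notMem, length]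
  intro hm
  obtain ⟨c, hc, e⟩ := Finset.mem_image.1 hm
  have e' : c.1 = i := e
  exact hn (mu.closed c hc _ le_rfl e'.ge (e' ▸ mu.le_of_mem c hc))

theorem doubling_cells_of_cells_eq (h : lam.cells = insert (i, j) mu.cells) :
    lam.doubling.cells = insert (i, j + 1) (insert (j, i) mu.doubling.cells) := by
  ext x
  simp only [doubling, h, Finset.image_insert, Finset.mem_union, Finset.mem_insert]
  tauto

theorem notMem_of_box (hij : i ≤ j) (hn : (i, j) ∉ mu.cells)
    (h : lam.cells = insert (i, j) mu.cells) :
    (i, j + 1) ∉ lam.cells ∧ (i + 1 ≤ j → (i + 1, j) ∉ lam.cells) ∧ (i + 1, j + 1) ∉ lam.cells := by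
  have key : ∀ x : ℕ × ℕ, x ≠ (i, j) → i ≤ x.1 → j ≤ x.2 → x ∉ lam.cells := by
    intro x hx h1 h2 hm
    rw [h, Finset.mem_insert] at hm
    exact hn (mu.closed x (hm.resolve_left hx) _ hij h1 h2)
  exact ⟨key _ (by simp) (by simp) (by simp), fun _ => key _ (by simp) (by simp) (by simp),
    key _ (by simp) (by simp) (by simp)⟩

theorem notMem_doubling_of_box (hij : i ≤ j) (hn : (i, j) ∉ mu.cells) :
    (i, j + 1) ∉ mu.doubling.cells ∧ (j, i) ∉ mu.doubling.cells := by
  rw [YoungDiagram.mem_cells, YoungDiagram.mem_cells, mem_doubling, mem_doubling,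
    Nat.add_sub_cancel]
  refine ⟨?_, ?_⟩
  · rintro (⟨-, hm⟩ | ⟨h', -⟩)
    · exact hn hm
    · omega
  · rintro (⟨h', -⟩ | ⟨-, hm⟩)
    · omega
    · exact hn hm

theorem right_mem_corners (hij : i ≤ j) (hn : (i, j) ∉ mu.cells)
    (h : lam.cells = insert (i, j) mu.cells) : (i, j + 1) ∈ lam.doubling.corners := by
  obtain ⟨h1, h2, h3⟩ := notMem_of_box hij hn h
  have hm : (i, j) ∈ lam.cells := by rw [h]; simp
  rw [YoungDiagram.mem_corners]
  simp only [mem_doubling, Nat.add_sub_cancel]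
  refine ⟨Or.inl ⟨by omega, hm⟩, ?_, ?_⟩
  · rintro (⟨h', hm'⟩ | ⟨h', hm'⟩)
    · exact h2 (by omega) hm'
    · obtain rfl : i = j := by omega
      exact h3 hm'
  · rintro (⟨h', hm'⟩ | ⟨h', hm'⟩)
    · exact h1 hm'
    · omega

theorem left_mem_corners (hij : i < j) (hn : (i, j) ∉ mu.cells)
    (h : lam.cells = insert (i, j) mu.cells) : (j, i) ∈ lam.doubling.corners := by
  obtain ⟨h1, h2, h3⟩ := notMem_of_box hij.le hn h
  have hm : (i, j) ∈ lam.cells := by rw [h]; simp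
  rw [YoungDiagram.mem_corners]
  simp only [mem_doubling]
  refine ⟨Or.inr ⟨hij.le, hm⟩, ?_, ?_⟩
  · rintro (⟨h', hm'⟩ | ⟨h', hm'⟩)
    · omega
    · exact h1 hm'
  · rintro (⟨h', hm'⟩ | ⟨h', hm'⟩)
    · omega
    · exact h2 hij hm'

theorem mem_between_of_cells_eq {ρ : YoungDiagram} {x y : ℕ × ℕ} (hx : x ∉ mu.doubling.cells)
    (hxρ : ρ.cells = insert x mu.doubling.cells) (hy : y ∉ ρ.cells)
    (hyρ : lam.doubling.cells = insert y ρ.cells) : ρ ∈ between mu lam := by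
  rw [mem_between]
  refine ⟨⟨YoungDiagram.cells_subset_iff.1 (hxρ ▸ Finset.subset_insert _ _), ?_⟩,
    YoungDiagram.cells_subset_iff.1 (hyρ ▸ Finset.subset_insert _ _), ?_⟩
  · rw [YoungDiagram.card, hxρ, Finset.card_insert_of_notMem hx]
  · rw [YoungDiagram.card, hyρ, Finset.card_insert_of_notMem hy]

theorem cells_of_mem_between (h : lam.cells = insert (i, j) mu.cells) {ρ : YoungDiagram}
    (hρ : ρ ∈ between mu lam) :
    ((i, j + 1) ∈ lam.doubling.corners ∧ ρ.cells = lam.doubling.cells.erase (i, j + 1)) ∨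
      ((j, i) ∈ lam.doubling.corners ∧ ρ.cells = lam.doubling.cells.erase (j, i)) := by
  rw [mem_between] at hρ
  obtain ⟨x, hx, e⟩ := YoungDiagram.up_iff.1 hρ.2
  have hxm : x ∈ lam.doubling.cells := (Finset.mem_filter.1 hx).1
  have hxn : x ∉ mu.doubling.cells := fun hm => by
    have : x ∈ ρ.cells := YoungDiagram.cells_subset_iff.2 hρ.1.1 hm
    rw [e] at this
    exact Finset.notMem_erase _ _ this
  rw [doubling_cells_of_cells_eq h, Finset.mem_insert, Finset.mem_insert] at hxm
  rcases hxm with rfl | rfl | hxm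
  · exact Or.inl ⟨hx, e⟩
  · exact Or.inr ⟨hx, e⟩
  · exact absurd hxm hxn

theorem exists_between_eq_pair (hij : i < j) (hn : (i, j) ∉ mu.cells)
    (h : lam.cells = insert (i, j) mu.cells) :
    ∃ ρa ρb : YoungDiagram, ρa ≠ ρb ∧ (∀ ρ, ρ ∈ between mu lam ↔ ρ = ρa ∨ ρ = ρb) ∧
      ρa.cells = insert (i, j + 1) mu.doubling.cells ∧
      ρb.cells = insert (j, i) mu.doubling.cells := by
  have hr := right_mem_corners hij.le hn h
  have hl := left_mem_corners hij hn h
  have hD := doubling_cells_of_cells_eq h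
  obtain ⟨hnr, hnl⟩ := notMem_doubling_of_box hij.le hn
  have hne : (i, j + 1) ≠ (j, i) := by simp only [ne_eq, Prod.mk.injEq]; omega
  have ea : (lam.doubling.eraseCorner _ hl).cells = insert (i, j + 1) mu.doubling.cells := by
    change lam.doubling.cells.erase (j, i) = _
    rw [hD, Finset.erase_insert_of_ne hne, Finset.erase_insert hnl]
  have eb : (lam.doubling.eraseCorner _ hr).cells = insert (j, i) mu.doubling.cells := by
    change lam.doubling.cells.erase (i, j + 1) = _
    rw [hD, Finset.erase_insert]
    rw [Finset.mem_insert, not_or]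
    exact ⟨hne, hnr⟩
  refine ⟨lam.doubling.eraseCorner _ hl, lam.doubling.eraseCorner _ hr, ?_, ?_, ea, eb⟩
  · intro e
    have : (i, j + 1) ∈ (lam.doubling.eraseCorner _ hl).cells := by rw [ea]; simp
    rw [e, eb, Finset.mem_insert] at this
    exact this.elim hne hnr
  · intro ρ
    constructor
    · intro hρ
      rcases cells_of_mem_between h hρ with ⟨-, e⟩ | ⟨-, e⟩
      · exact Or.inr (YoungDiagram.ext e)
      · exact Or.inl (YoungDiagram.ext e)
    · rintro (rfl | rfl)
      · refine mem_between_of_cells_eq hnr ea (y := (j, i)) ?_ ?_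
        · rw [ea, Finset.mem_insert, not_or]
          exact ⟨hne.symm, hnl⟩
        · rw [ea, hD, Finset.insert_comm]
      · refine mem_between_of_cells_eq hnl eb (y := (i, j + 1)) ?_ ?_
        · rw [eb, Finset.mem_insert, not_or]
          exact ⟨hne, hnr⟩
        · rw [eb, hD]

theorem exists_between_eq_singleton (hn : (i, i) ∉ mu.cells)
    (h : lam.cells = insert (i, i) mu.cells) :
    ∃ ρ₁ : YoungDiagram, (∀ ρ, ρ ∈ between mu lam ↔ ρ = ρ₁) ∧
      ρ₁.cells = insert (i, i) mu.doubling.cells := by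
  have hr := right_mem_corners le_rfl hn h
  have hD := doubling_cells_of_cells_eq h
  obtain ⟨hnr, hnl⟩ := notMem_doubling_of_box le_rfl hn
  have hni : (i, i + 1) ∉ insert (i, i) mu.doubling.cells := by
    rw [Finset.mem_insert, not_or]
    exact ⟨by simp, hnr⟩
  have eb : (lam.doubling.eraseCorner _ hr).cells = insert (i, i) mu.doubling.cells := by
    change lam.doubling.cells.erase (i, i + 1) = _
    rw [hD, Finset.erase_insert hni]
  refine ⟨lam.doubling.eraseCorner _ hr, fun ρ => ⟨fun hρ => ?_, ?_⟩, eb⟩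
  · rcases cells_of_mem_between h hρ with ⟨-, e⟩ | ⟨hc, -⟩
    · exact YoungDiagram.ext e
    · rw [YoungDiagram.mem_corners] at hc
      exact absurd (YoungDiagram.mem_corners.1 hr).1 hc.2.2
  · rintro rfl
    refine mem_between_of_cells_eq hnl eb (y := (i, i + 1)) ?_ ?_
    · rwa [eb]
    · rw [eb, hD]

end Box

end ShiftedDiagram

theorem YoungDiagram.normCount_eq_of_cells_eq {σ ρ : YoungDiagram} {b : ℕ × ℕ} (h : σ.Up ρ)
    (hb : b ∉ σ.cells) (e : ρ.cells = insert b σ.cells) :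
    σ.normCount = ρ.normCount * |σ.weight (boxContent b)| := by
  have hbρ : b ∈ ρ.cells := by rw [e]; exact Finset.mem_insert_self _ _
  rw [normCount_eq_mul_abs_weight h, addedContent_of_cells_eq hbρ (by
    rw [e, Finset.erase_insert hb])]

namespace ShiftedDiagram

theorem abs_weight_doubling_reflect (mu : ShiftedDiagram) (c : ℕ) (hc : 1 ≤ c) :
    (c : ℝ) * |mu.doubling.weight (c + 1)| = (c + 1) * |mu.doubling.weight (-c)| := by
  have h1 : |dropZero (c + 1)| = (c : ℝ) + 1 := by
    rw [dropZero, if_neg (by omega)]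
    push_cast
    exact abs_of_pos (by positivity)
  have h2 : |dropZero (-c)| = (c : ℝ) := by
    rw [abs_dropZero_neg, dropZero, if_neg (by omega)]
    simp
  rw [YoungDiagram.weight, YoungDiagram.weight, abs_mul, abs_mul, h1, h2, Finset.abs_prod,
    Finset.abs_prod, mu.prod_doubling fun k => |contentFactor (c + 1 - k)|,
    mu.prod_doubling fun k => |contentFactor (-c - k)|]
  have : ∀ b ∈ mu.cells, |contentFactor (c + 1 - (boxContent b + 1))|
      * |contentFactor (c + 1 - -boxContent b)|
      = |contentFactor (-c - (boxContent b + 1))| * |contentFactor (-c - -boxContent b)| := by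
    intro b _
    rw [mul_comm, ← abs_contentFactor_neg (c + 1 - -boxContent b),
      ← abs_contentFactor_neg (c + 1 - (boxContent b + 1))]
    congr 3 <;> ring
  rw [Finset.prod_congr rfl this]
  ring

theorem abs_weight_doubling_diag (mu : ShiftedDiagram) :
    |mu.doubling.weight 1| = |mu.doubling.weight 0| := by
  rw [YoungDiagram.weight, YoungDiagram.weight, abs_mul, abs_mul, Finset.abs_prod,
    Finset.abs_prod, mu.prod_doubling fun k => |contentFactor (1 - k)|,
    mu.prod_doubling fun k => |contentFactor (0 - k)|]
  have : ∀ b ∈ mu.cells, |contentFactor (1 - (boxContent b + 1))|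
      * |contentFactor (1 - -boxContent b)|
      = |contentFactor (0 - (boxContent b + 1))| * |contentFactor (0 - -boxContent b)| := by
    intro b _
    rw [mul_comm, ← abs_contentFactor_neg (1 - -boxContent b),
      ← abs_contentFactor_neg (1 - (boxContent b + 1))]
    congr 3 <;> ring
  rw [Finset.prod_congr rfl this]
  simp [dropZero]

theorem sum_between_sq {mu lam : ShiftedDiagram} (h : mu.Up lam) :
    2 ^ lam.length * (∑ ρ ∈ between mu lam, ρ.normCount) ^ 2
      = 4 * 2 ^ mu.length * (mu.doubling.normCount * lam.doubling.normCount) := by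
  classical
  obtain ⟨i, j, hij, hn, e⟩ := exists_box_of_up h
  have hD := doubling_cells_of_cells_eq e
  obtain ⟨hnr, hnl⟩ := notMem_doubling_of_box hij hn
  rcases hij.lt_or_eq with hlt | rfl
  · obtain ⟨ρa, ρb, hne, hbt, ea, eb⟩ := exists_between_eq_pair hlt hn e
    have hset : between mu lam = {ρa, ρb} := by
      ext ρ
      rw [hbt, Finset.mem_insert, Finset.mem_singleton]
    rw [hset, Finset.sum_pair hne, length_of_lt hlt e]
    have ha := mem_between.1 ((hbt ρa).2 (Or.inl rfl))
    have hb := mem_between.1 ((hbt ρb).2 (Or.inr rfl))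
    have hnla : (j, i) ∉ ρa.cells := by
      rw [ea, Finset.mem_insert, not_or]
      exact ⟨by simp only [Prod.mk.injEq]; omega, hnl⟩
    have h1 := YoungDiagram.normCount_eq_of_cells_eq ha.1 hnr ea
    have h2 := YoungDiagram.normCount_eq_of_cells_eq hb.1 hnl eb
    have h3 := YoungDiagram.normCount_eq_of_cells_eq ha.2 hnla (by rw [ea, hD, Finset.insert_comm])
    obtain ⟨c, rfl⟩ : ∃ c, j = i + c := ⟨j - i, by omega⟩
    have hc : 1 ≤ c := by omega
    have c1 : boxContent (i, i + c + 1) = (c : ℤ) + 1 := by simp only [boxContent]; push_cast; ring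
    have c2 : boxContent (i + c, i) = -(c : ℤ) := by simp only [boxContent]; push_cast; ring
    rw [YoungDiagram.weight_of_cells_eq (σ := mu.doubling) (b := (i, i + c + 1))
      (by rw [ea]; exact Finset.mem_insert_self _ _) (by rw [ea, Finset.erase_insert hnr]),
      c2, abs_mul, c1] at h3
    rw [c1] at h1
    rw [c2] at h2
    have h4 := abs_weight_doubling_reflect mu c hc
    have h5 : |contentFactor (-(c : ℤ) - (c + 1))|
        = 4 * c * (c + 1) / (2 * (c : ℝ) + 1) ^ 2 := by
      have : |(-(c : ℤ) - (c + 1))| = 2 * c + 1 := by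
        rw [show (-(c : ℤ) - (c + 1)) = -(2 * c + 1) by ring, abs_neg]
        exact abs_of_nonneg (by positivity)
      rw [contentFactor_of_two_le (by rw [this]; omega)]
      push_cast
      rw [show ((-(c : ℝ) - (c + 1)) ^ 2 - 1) / (-(c : ℝ) - (c + 1)) ^ 2
        = 4 * c * (c + 1) / (2 * (c : ℝ) + 1) ^ 2 by congr 1 <;> ring]
      exact abs_of_nonneg (by positivity)
    rw [h5] at h3
    have hc0 : (0 : ℝ) < c := by exact_mod_cast hc
    have hw : |mu.doubling.weight (-c)| ≠ 0 := abs_ne_zero.2 (YoungDiagram.weight_ne_zero _ _)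
    have h6 : (c : ℝ) * ρb.normCount = (c + 1) * ρa.normCount := by
      apply mul_right_cancel₀ hw
      linear_combination (-(c : ℝ)) * h2 + c * h1 + ρa.normCount * h4
    have h7 : ρb.normCount = (c + 1) / c * ρa.normCount := by
      field_simp
      linear_combination h6
    have h8 : ρa.normCount * (2 * (c : ℝ) + 1) ^ 2
        = 4 * c * (c + 1) * lam.doubling.normCount * |mu.doubling.weight (-c)| := by
      rw [h3]
      field_simp
    have h9 : c ^ 2 * (ρa.normCount + ρb.normCount) ^ 2
        = ρa.normCount ^ 2 * (2 * (c : ℝ) + 1) ^ 2 := by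
      rw [h7]
      field_simp
      ring
    have h10 : (c : ℝ) ^ 2 * (ρa.normCount + ρb.normCount) ^ 2
        = c ^ 2 * (4 * (mu.doubling.normCount * lam.doubling.normCount)) := by
      rw [h9]
      linear_combination ρa.normCount * h8 - 4 * c * lam.doubling.normCount *
        |mu.doubling.weight (-c)| * h6 - 4 * c ^ 2 * lam.doubling.normCount * h2
    have h11 := mul_left_cancel₀ (pow_ne_zero 2 hc0.ne') h10
    rw [h11]
    ring
  · obtain ⟨ρ, hbt, e'⟩ := exists_between_eq_singleton hn e
    have hset : between mu lam = {ρ} := by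
      ext ρ
      rw [hbt, Finset.mem_singleton]
    rw [hset, Finset.sum_singleton, length_of_eq hn e]
    have ha := mem_between.1 ((hbt ρ).2 rfl)
    have h1 := YoungDiagram.normCount_eq_of_cells_eq ha.1 hnl e'
    have h2 := YoungDiagram.normCount_eq_of_cells_eq ha.2 (b := (i, i + 1)) (by
      rw [e', Finset.mem_insert, not_or]
      exact ⟨by simp, hnr⟩) (by rw [e', hD])
    have c1 : boxContent (i, i + 1) = 1 := by simp [boxContent]
    have c2 : boxContent (i, i) = 0 := by simp [boxContent]
    rw [YoungDiagram.weight_of_cells_eq (σ := mu.doubling) (b := (i, i))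
      (by rw [e']; exact Finset.mem_insert_self _ _) (by rw [e', Finset.erase_insert hnl]),
      c1, c2, abs_mul, abs_weight_doubling_diag,
      show |contentFactor (1 - 0)| = 2 by norm_num [contentFactor, dropZero]] at h2
    rw [c2] at h1
    rw [h1, pow_succ, sq]
    nth_rewrite 2 [h2]
    ring

/-- The square root of `2 ^ ℓ(lam)` times the normalized number of paths to the doubling. -/
noncomputable def rootCount (lam : ShiftedDiagram) : ℝ :=
  √(2 ^ lam.length * lam.doubling.normCount)

theorem rootCount_pos (lam : ShiftedDiagram) : 0 < lam.rootCount :=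
  Real.sqrt_pos.2 (mul_pos (by positivity) lam.doubling.normCount_pos)

theorem rootCount_sq (lam : ShiftedDiagram) :
    lam.rootCount ^ 2 = 2 ^ lam.length * lam.doubling.normCount :=
  Real.sq_sqrt (mul_pos (by positivity) lam.doubling.normCount_pos).le

theorem rootCount_mul_rootCount {mu lam : ShiftedDiagram} (h : mu.Up lam) :
    2 * (mu.rootCount * lam.rootCount)
      = 2 ^ lam.length * ∑ ρ ∈ between mu lam, ρ.normCount := by
  refine (sq_eq_sq₀ ?_ ?_).1 ?_
  · have := mu.rootCount_pos
    have := lam.rootCount_pos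
    positivity
  · exact mul_nonneg (by positivity) (Finset.sum_nonneg fun ρ _ => ρ.normCount_pos.le)
  · rw [mul_pow, mul_pow, rootCount_sq, rootCount_sq, mul_pow, sq (2 ^ lam.length), mul_assoc _ _
      (_ ^ 2), sum_between_sq h]
    ring

theorem sum_rootCount_down (lam : ShiftedDiagram) :
    ∑ mu ∈ lam.down, mu.rootCount = lam.card * lam.rootCount := by
  have h1 : ∑ mu ∈ lam.down, 2 * (mu.rootCount * lam.rootCount)
      = 2 * (lam.card * lam.rootCount * lam.rootCount) := by
    rw [Finset.sum_congr rfl fun mu hmu => rootCount_mul_rootCount (mem_down.1 hmu),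
      ← Finset.mul_sum, ← sum_down_doubling, YoungDiagram.sum_normCount_down, card_doubling,
      mul_assoc (lam.card : ℝ), ← sq, rootCount_sq]
    push_cast
    ring
  rw [← Finset.mul_sum, ← Finset.sum_mul] at h1
  exact mul_right_cancel₀ lam.rootCount_pos.ne' (mul_left_cancel₀ two_ne_zero h1)

/-- The numbers of paths in the Schur graph and in the Young graph are related by
`g_lam ^ 2 / |lam|! ^ 2 = 2 ^ ℓ(lam) * f_{𝒟 lam} / (2 |lam|)!`. -/
theorem pathCount_eq_factorial_mul_rootCount (lam : ShiftedDiagram) :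
    (lam.pathCount : ℝ) = lam.card.factorial * lam.rootCount := by
  induction hn : lam.card generalizing lam with
  | zero =>
    rw [eq_empty_of_card_eq_zero hn, pathCount_empty, rootCount, doubling_empty,
      YoungDiagram.normCount, YoungDiagram.pathCount_bot]
    simp [length, empty, YoungDiagram.card]
  | succ n ih =>
    have hne : lam ≠ empty := by
      rintro rfl
      simp [card, empty] at hn
    rw [pathCount_eq_sum hne]
    push_cast
    rw [Finset.sum_congr rfl fun mu hmu => ih mu (by have := (mem_down.1 hmu).2; omega),
      ← Finset.mul_sum, sum_rootCount_down, hn, Nat.factorial_succ]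
    push_cast
    ring

theorem plancherelUp_eq {mu lam : ShiftedDiagram} (h : mu.Up lam) :
    mu.plancherelUp lam = ∑ ρ ∈ between mu lam, mu.doubling.plancherelUp ρ := by
  rw [Finset.sum_congr rfl fun ρ hρ => YoungDiagram.plancherelUp_eq (mem_between.1 hρ).1,
    ← Finset.sum_div, plancherelUp, if_pos h, pathCount_eq_factorial_mul_rootCount,
    pathCount_eq_factorial_mul_rootCount, h.2, Nat.factorial_succ]
  have h1 := rootCount_mul_rootCount h
  have h2 := mu.rootCount_sq
  have h3 := mu.rootCount_pos.ne'
  have h4 := mu.doubling.normCount_pos.ne'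
  have h5 := Nat.factorial_ne_zero mu.card
  rw [zpow_add₀ two_ne_zero, zpow_sub₀ two_ne_zero, zpow_one, zpow_natCast, zpow_natCast,
    eq_div_iff h4]
  push_cast
  field_simp
  linear_combination mu.rootCount * h1 - 2 * lam.rootCount * h2

end ShiftedDiagram

theorem nuParam_sq (α : ℝ) : nuParam α ^ 2 = (1 - 4 * (α : ℂ)) / 4 := by
  have h : ((1 - 4 * (α : ℂ)) ^ (1 / 2 : ℂ)) ^ 2 = 1 - 4 * (α : ℂ) := by
    have := Complex.cpow_nat_inv_pow (1 - 4 * (α : ℂ)) two_ne_zero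
    rwa [Nat.cast_ofNat, ← one_div] at this
  rw [nuParam, mul_pow, h]
  ring

theorem zParam_add_mul_zParam'_add (α : ℝ) (k : ℂ) :
    (zParam α + k) * (zParam' α + k) = k * (k - 1) + α := by
  rw [zParam, zParam']
  linear_combination -nuParam_sq α

theorem zParam_mul_zParam' (α : ℝ) : zParam α * zParam' α = α := by
  simpa using zParam_add_mul_zParam'_add α 0

theorem zAdmissible_params {α : ℝ} (hα : 0 < α) : ZAdmissible (zParam α) (zParam' α) := by
  have hsq := nuParam_sq α
  have hcast : (1 - 4 * (α : ℂ)) / 4 = (((1 - 4 * α) / 4 : ℝ) : ℂ) := by push_cast; ring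
  rw [hcast, sq] at hsq
  have hre := congrArg Complex.re hsq
  have him := congrArg Complex.im hsq
  rw [Complex.mul_re, Complex.ofReal_re] at hre
  rw [Complex.mul_im, Complex.ofReal_im] at him
  have hprod : (nuParam α).re * (nuParam α).im = 0 := by linarith
  rcases mul_eq_zero.1 hprod with h | h
  · left
    constructor
    · apply Complex.ext <;> simp [zParam, zParam', h]
    · intro m hm
      have h1 := congrArg Complex.re hm
      rw [zParam, Complex.sub_re, h, Complex.intCast_re] at h1
      norm_num at h1
      have h2 : (2 * m : ℝ) = -1 := by linarith
      have h3 : 2 * m = -1 := by exact_mod_cast h2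
      omega
  · right
    have hreal : nuParam α = ((nuParam α).re : ℂ) := Complex.ext (by simp) (by simp [h])
    set x := (nuParam α).re with hx
    rw [h] at hre
    have h1 : x < 1 / 2 := by nlinarith
    have h2 : -(1 / 2) < x := by nlinarith
    refine ⟨x - 1 / 2, -x - 1 / 2, ?_, ?_, -1, ?_⟩
    · rw [zParam, hreal]
      push_cast
      ring
    · rw [zParam', hreal]
      push_cast
      ring
    · push_cast
      refine ⟨?_, ?_, ?_, ?_⟩ <;> linarith

theorem YoungDiagram.addedContent_of_cells_eq_insert {σ ρ : YoungDiagram} {b : ℕ × ℕ}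
    (hb : b ∉ σ.cells) (h : ρ.cells = insert b σ.cells) : σ.addedContent ρ = boxContent b := by
  rw [addedContent, h, Finset.insert_sdiff_of_notMem _ hb, Finset.sdiff_self]
  simp

theorem YoungDiagram.up_of_zUp_ne_zero {z z' : ℂ} {σ ρ : YoungDiagram} (h : σ.zUp z z' ρ ≠ 0) :
    σ.Up ρ := by
  by_contra hn
  exact h (by simp [zUp, plancherelUp, hn])

namespace ShiftedDiagram

theorem up_of_alphaUp_ne_zero {α : ℝ} {mu lam : ShiftedDiagram} (h : mu.alphaUp α lam ≠ 0) :
    mu.Up lam := by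
  by_contra hn
  exact h (by simp [alphaUp, plancherelUp, hn])

theorem addedContent_mul_pred_of_mem_between {mu lam : ShiftedDiagram} (h : mu.Up lam)
    {ρ : YoungDiagram} (hρ : ρ ∈ between mu lam) :
    mu.doubling.addedContent ρ * (mu.doubling.addedContent ρ - 1)
      = mu.addedContent lam * (mu.addedContent lam + 1) := by
  obtain ⟨i, j, hij, hn, e⟩ := exists_box_of_up h
  obtain ⟨hnr, hnl⟩ := notMem_doubling_of_box hij hn
  rw [addedContent_of_cells_eq hn e]
  rcases hij.lt_or_eq with hlt | rfl
  · obtain ⟨ρa, ρb, -, hbt, ea, eb⟩ := exists_between_eq_pair hlt hn e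
    rcases (hbt ρ).1 hρ with rfl | rfl
    · rw [YoungDiagram.addedContent_of_cells_eq_insert hnr ea]
      simp only [boxContent]
      push_cast
      ring
    · rw [YoungDiagram.addedContent_of_cells_eq_insert hnl eb]
      simp only [boxContent]
      ring
  · obtain ⟨ρ₁, hbt, e'⟩ := exists_between_eq_singleton hn e
    obtain rfl := (hbt ρ).1 hρ
    rw [YoungDiagram.addedContent_of_cells_eq_insert hnl e']
    simp [boxContent]

theorem alphaUp_eq_sum_zUp (α : ℝ) {mu lam : ShiftedDiagram} (h : mu.Up lam) :
    (mu.alphaUp α lam : ℂ)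
      = ∑ ρ ∈ between mu lam, mu.doubling.zUp (zParam α) (zParam' α) ρ := by
  rw [alphaUp, plancherelUp_eq h]
  push_cast
  rw [Finset.mul_sum]
  refine Finset.sum_congr rfl fun ρ hρ => ?_
  have hc : ((mu.doubling.addedContent ρ : ℂ) * (mu.doubling.addedContent ρ - 1))
      = mu.addedContent lam * (mu.addedContent lam + 1) := by
    exact_mod_cast addedContent_mul_pred_of_mem_between h hρ
  rw [YoungDiagram.zUp, zParam_add_mul_zParam'_add, zParam_mul_zParam', card_doubling, hc]
  push_cast
  rw [add_comm (α : ℂ) (2 * _)]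

theorem transition_identity (α : ℝ) {mu lam : ShiftedDiagram} (h : mu.Up lam) :
    (lam.length = mu.length ∨ lam.length = mu.length + 1) ∧
      (lam.length = mu.length →
        ∃ ρa ρb : YoungDiagram, ρa ≠ ρb ∧
          (∀ ρ : YoungDiagram,
            (mu.doubling.Up ρ ∧ ρ.Up lam.doubling) ↔ (ρ = ρa ∨ ρ = ρb)) ∧
          (mu.alphaUp α lam : ℂ) =
            mu.doubling.zUp (zParam α) (zParam' α) ρa
              + mu.doubling.zUp (zParam α) (zParam' α) ρb) ∧
      (lam.length = mu.length + 1 →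
        ∃ ρ₁ : YoungDiagram,
          (∀ ρ : YoungDiagram, (mu.doubling.Up ρ ∧ ρ.Up lam.doubling) ↔ ρ = ρ₁) ∧
          (mu.alphaUp α lam : ℂ) = mu.doubling.zUp (zParam α) (zParam' α) ρ₁) := by
  classical
  obtain ⟨i, j, hij, hn, e⟩ := exists_box_of_up h
  simp only [← mem_between]
  rw [alphaUp_eq_sum_zUp α h]
  rcases hij.lt_or_eq with hlt | rfl
  · have hl := length_of_lt hlt e
    refine ⟨Or.inl hl, fun _ => ?_, fun h' => by omega⟩
    obtain ⟨ρa, ρb, hne, hbt, -, -⟩ := exists_between_eq_pair hlt hn e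
    refine ⟨ρa, ρb, hne, hbt, ?_⟩
    have hset : between mu lam = {ρa, ρb} := by
      ext ρ
      rw [hbt, Finset.mem_insert, Finset.mem_singleton]
    rw [hset, Finset.sum_pair hne]
  · have hl := length_of_eq hn e
    refine ⟨Or.inr hl, fun h' => by omega, fun _ => ?_⟩
    obtain ⟨ρ₁, hbt, -⟩ := exists_between_eq_singleton hn e
    refine ⟨ρ₁, hbt, ?_⟩
    have hset : between mu lam = {ρ₁} := by
      ext ρ
      rw [hbt, Finset.mem_singleton]
    rw [hset, Finset.sum_singleton]

theorem alphaMeasure_succ (α : ℝ) (n : ℕ) (lam : ShiftedDiagram) :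
    alphaMeasure α (n + 1) lam = ∑ mu ∈ lam.down, alphaMeasure α n mu * mu.alphaUp α lam := by
  rw [alphaMeasure, finsum_eq_sum_of_support_subset]
  intro mu hmu
  exact mem_down.2 (up_of_alphaUp_ne_zero (right_ne_zero_of_mul hmu))

end ShiftedDiagram

open ShiftedDiagram

theorem exists_ne_zero_of_finsum_ne_zero {ι M : Type*} [AddCommMonoid M] {f : ι → M}
    (h : ∑ᶠ i, f i ≠ 0) : ∃ i, f i ≠ 0 := by
  by_contra! hf
  exact h (by rw [funext hf]; exact finsum_zero)

theorem forcedGrowth_two_mul_add_one (z z' : ℂ) (n : ℕ) (ρ : YoungDiagram) :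
    forcedGrowth z z' (2 * n + 1) ρ
      = ∑ᶠ σ : YoungDiagram, forcedGrowth z z' (2 * n) σ * σ.zUp z z' ρ := by
  rw [forcedGrowth, if_pos (even_two_mul n)]

theorem forcedGrowth_two_mul_succ (z z' : ℂ) (n : ℕ) (τ : YoungDiagram) :
    forcedGrowth z z' (2 * (n + 1)) τ
      = ∑ᶠ ρ : YoungDiagram, forcedGrowth z z' (2 * n + 1) ρ * forcedStep ρ τ := by
  rw [show 2 * (n + 1) = (2 * n + 1) + 1 by ring, forcedGrowth, if_neg]
  rw [Nat.not_even_iff_odd]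
  exact ⟨n, rfl⟩

theorem forcedGrowth_support (z z' : ℂ) (n : ℕ) (τ : YoungDiagram)
    (h : forcedGrowth z z' (2 * n) τ ≠ 0) :
    ∃ lam : ShiftedDiagram, lam.card = n ∧ lam.doubling = τ := by
  induction n generalizing τ with
  | zero =>
    rw [mul_zero, forcedGrowth] at h
    refine ⟨empty, rfl, ?_⟩
    rw [doubling_empty]
    by_contra hn
    exact h (if_neg fun e => hn e.symm)
  | succ n ih =>
    rw [forcedGrowth_two_mul_succ] at h
    obtain ⟨ρ, hρ⟩ := exists_ne_zero_of_finsum_ne_zero h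
    have hstep : ρ.Up τ ∧ τ.DSymmetric := by
      by_contra hn
      exact right_ne_zero_of_mul hρ (if_neg hn)
    have hW := left_ne_zero_of_mul hρ
    rw [forcedGrowth_two_mul_add_one] at hW
    obtain ⟨σ, hσ⟩ := exists_ne_zero_of_finsum_ne_zero hW
    obtain ⟨mu, hmu, rfl⟩ := ih σ (left_ne_zero_of_mul hσ)
    have hup := YoungDiagram.up_of_zUp_ne_zero (right_ne_zero_of_mul hσ)
    obtain ⟨hup', lam, rfl⟩ := hstep
    refine ⟨lam, ?_, rfl⟩
    have h1 := hup.2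
    have h2 := hup'.2
    rw [card_doubling] at h1 h2
    omega

theorem forcedGrowth_of_doubling_up (z z' : ℂ) (n : ℕ) {mu : ShiftedDiagram} {ρ : YoungDiagram}
    (h : mu.doubling.Up ρ) :
    forcedGrowth z z' (2 * n + 1) ρ
      = forcedGrowth z z' (2 * n) mu.doubling * mu.doubling.zUp z z' ρ := by
  rw [forcedGrowth_two_mul_add_one]
  refine finsum_eq_single _ mu.doubling fun σ hσ => ?_
  by_contra hne
  obtain ⟨mu', -, rfl⟩ := forcedGrowth_support z z' n σ (left_ne_zero_of_mul hne)
  have h' := YoungDiagram.up_of_zUp_ne_zero (right_ne_zero_of_mul hne)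
  exact hσ (by rw [← (lowerHalf_eq_of_up h').1, (lowerHalf_eq_of_up h).1])

theorem forcedGrowth_succ_doubling (z z' : ℂ) (n : ℕ) (lam : ShiftedDiagram) :
    forcedGrowth z z' (2 * (n + 1)) lam.doubling
      = ∑ mu ∈ lam.down, forcedGrowth z z' (2 * n) mu.doubling
        * ∑ ρ ∈ between mu lam, mu.doubling.zUp z z' ρ := by
  rw [forcedGrowth_two_mul_succ,
    finsum_eq_sum_of_support_subset (s := lam.doubling.down), sum_down_doubling]
  · refine Finset.sum_congr rfl fun mu _ => ?_
    rw [Finset.mul_sum]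
    refine Finset.sum_congr rfl fun ρ hρ => ?_
    rw [mem_between] at hρ
    rw [forcedGrowth_of_doubling_up z z' n hρ.1, forcedStep, if_pos ⟨hρ.2, lam, rfl⟩, mul_one]
  · intro ρ hρ
    rw [Finset.mem_coe, YoungDiagram.mem_down]
    by_contra hn
    exact right_ne_zero_of_mul hρ (if_neg fun h => hn h.1)

theorem forcedGrowth_doubling (α : ℝ) (n : ℕ) (lam : ShiftedDiagram) :
    forcedGrowth (zParam α) (zParam' α) (2 * n) lam.doubling = (alphaMeasure α n lam : ℂ) := by
  induction n generalizing lam with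
  | zero =>
    rw [mul_zero, forcedGrowth, alphaMeasure, ← doubling_empty]
    by_cases h : lam = empty
    · rw [if_pos h, if_pos (congrArg doubling h), Complex.ofReal_one]
    · rw [if_neg h, if_neg (doubling_injective.ne h), Complex.ofReal_zero]
  | succ n ih =>
    rw [forcedGrowth_succ_doubling, alphaMeasure_succ]
    push_cast
    refine Finset.sum_congr rfl fun mu hmu => ?_
    rw [ih, alphaUp_eq_sum_zUp α (mem_down.1 hmu)]

theorem mainTheorem1 (α : ℝ) (hα : 0 < α) :
    -- the parameters are admissible for the z-measures
    ZAdmissible (zParam α) (zParam' α) ∧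
    -- the identity between the up transition probabilities
    (∀ mu lam : ShiftedDiagram, mu.Up lam →
      (lam.length = mu.length ∨ lam.length = mu.length + 1) ∧
      (lam.length = mu.length →
        ∃ ρa ρb : YoungDiagram, ρa ≠ ρb ∧
          (∀ ρ : YoungDiagram,
            (mu.doubling.Up ρ ∧ ρ.Up lam.doubling) ↔ (ρ = ρa ∨ ρ = ρb)) ∧
          (mu.alphaUp α lam : ℂ) =
            mu.doubling.zUp (zParam α) (zParam' α) ρa
              + mu.doubling.zUp (zParam α) (zParam' α) ρb) ∧
      (lam.length = mu.length + 1 →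
        ∃ ρ₁ : YoungDiagram,
          (∀ ρ : YoungDiagram, (mu.doubling.Up ρ ∧ ρ.Up lam.doubling) ↔ ρ = ρ₁) ∧
          (mu.alphaUp α lam : ℂ) = mu.doubling.zUp (zParam α) (zParam' α) ρ₁)) ∧
    -- the forced step of the growth process is well defined
    (∀ (mu : ShiftedDiagram) (ρ : YoungDiagram), mu.doubling.Up ρ →
      ∃! τ : YoungDiagram, ρ.Up τ ∧ τ.DSymmetric) ∧
    -- after 2n steps the forced growth process is at the doubling of a random shifted diagram
    -- with n boxes distributed according to Borodin's measure
    (∀ n : ℕ,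
      (∀ lam : ShiftedDiagram,
        forcedGrowth (zParam α) (zParam' α) (2 * n) lam.doubling
          = (ShiftedDiagram.alphaMeasure α n lam : ℂ)) ∧
      (∀ τ : YoungDiagram, forcedGrowth (zParam α) (zParam' α) (2 * n) τ ≠ 0 →
        ∃ lam : ShiftedDiagram, lam.card = n ∧ lam.doubling = τ)) := by
  exact ⟨zAdmissible_params hα, fun _ _ h => transition_identity α h,
    fun _ _ h => existsUnique_forced h,
    fun n => ⟨forcedGrowth_doubling α n, forcedGrowth_support _ _ n⟩⟩
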